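/- Let $n,m\ge 0$, let $f:\mathbb{R}^n\to\mathbb{R}$ be $C^2$ and strongly convex (that is, $f-\frac{\alpha}{2}\|\cdot\|^2$ is convex for some modulus $\alpha>0$), and let $g_1,\dots,g_m:\mathbb{R}^n\to\mathbb{R}$ be $C^2$, convex and Lipschitz continuous, such that $g=(g_1,\dots,g_m)$ has a bounded Jacobian, i.e. $\sup_x\|\nabla g(x)\|_F<\infty$. Let $x^*$ be the solution (assumed to exist; it is unique) of $$\min f(x)\quad\text{subject to}\quad g_k(x)\le 0,\ k=1,\dots,m,\quad x\in\mathbb{R}^n .$$ For $\lambda\in\mathbb{R}^m_+$ let $q(\lambda)=\min_{x\in\mathbb{R}^n}\{f(x)+\sum_k\lambda_kg_k(x)\}$ be the Lagrangian dual function. A Lagrange multiplier is a vector $\lambda^*\in\mathbb{R}^m_+$ with $q(\lambda^*)=f(x^*)$. Consider the following assumptions. - Assumption 1: $f$ is strongly convex with a modulus $\alpha>0$ and all the $g_k$ are Lipschitz continuous with a common modulus $\beta>0$. - Assumption 2 (strong duality): a Lagrange multiplier exists. - Assumption 3 (smooth dual): for some $\gamma>0$, $q$ is smooth on $\mathbb{R}^m_+$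 with modulus $\gamma$, i.e. it is differentiable on $\mathbb{R}^m_+$ (relative to $\mathbb{R}^m_+$) and its gradient is Lipschitz continuous there with modulus $\gamma$. - Assumption 4 (locally quadratic dual): for a Lagrange multiplier $\lambda^*$ there are $D_q,L_q>0$ with $q(\lambda^*)\ge q(\lambda)+L_q\|\lambda-\lambda^*\|^2$ for all $\lambda\in\mathbb{R}^m_+$ with $\|\lambda-\lambda^*\|\le D_q$. - Assumption 5 (locally strongly concave dual): for a Lagrange multiplier $\lambda^*$ there are $D_c,L_c>0$ such that $q$ is strongly concave with modulus $L_c$ on $\{\lambda\in\mathbb{R}^m_+:\|\lambda-\lambda^*\|\le D_c\}$. The drift-plus-penalty algorithm with shifted running averages, with parameter $V>0$ and initial queues $Q(0)\in\mathbb{R}^m_+$, computes for $t=0,1,2,\dots$ $$x(t)=\operatorname*{argmin}_{x\in\mathbb{R}^n}\Big[Vf(x)+\sum_kQ_k(t)g_k(x)\Big],\qquad Q_k(t+1)=\max\{Q_k(t)+g_k(x(t)),0\},$$ $$\overline{x}(t+1)=\frac{1}{(t+1)/2}\sum_{\tau=(t+1)/2}^{t}x(\tau)\ \text{ if } t+1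 \text{ is even},\qquad \overline{x}(t+1)=\overline{x}(t)\ \text{ if } t+1\text{ is odd}.$$ Its error decays like $O(r(t))$ if there are constants $C\ge 0$ and $T$ with $f(\overline{x}(t))\le f(x^*)+Cr(t)$ and $g_k(\overline{x}(t))\le Cr(t)$ for all $k$ and all $t\ge T$. Its convergence time is $O(h(\epsilon))$ if there is a constant $C>0$ such that, for all sufficiently small $\epsilon>0$ and all $t\ge Ch(\epsilon)$, the point $\overline{x}(t)$ is $\epsilon$-optimal, i.e. $f(\overline{x}(t))\le f(x^*)+\epsilon$ and $g_k(\overline{x}(t))\le\epsilon$ for all $k$. The constants $C$ and $T$ may depend on the problem, on $V$ and on $Q(0)$. 1. Let $\mathcal{K}=\{k:g_k(x^*)=0\}$. If the Jacobian of the active constraints satisfies $\operatorname{rank}\nabla g_{\mathcal{K}}(x^*)=|\mathcal{K}|$, then $q$ is well defined (the minimum is attained for every $\lambda\in\mathbb{R}^m_+$) and Assumptions 1, 2, 3 and 4 hold (the last one at every Lagrange multiplier). Moreover, for all moduli $\alpha,\beta,\gamma$ as in Assumptions 1 and 3, all $V>0$ with $V\ge\max\{m\beta^2/\alpha,\gamma\}$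 and all $Q(0)\in\mathbb{R}^m_+$, the algorithm can be run (the minimizers exist), its error decays like $O(1/t^{3/2})$, and its convergence time is $O(1/\epsilon^{2/3})$. 2. If the full Jacobian satisfies $\operatorname{rank}\nabla g(x^*)=m$, then $q$ is well defined and Assumptions 1, 2, 3 and 5 hold (the last one at every Lagrange multiplier). Moreover, for all moduli $\alpha,\beta,\gamma$ as in Assumptions 1 and 3, all $V>0$ with $V\ge\max\{m\beta^2/\alpha,\gamma\}$ and all $Q(0)\in\mathbb{R}^m_+$, the algorithm can be run; for every $\lambda^*,D_c,L_c$ as in Assumption 5 its error decays like $O\big(\frac1t(1-\frac{L_c}{V})^{t/4}\big)$; and its convergence time is $O(\log(1/\epsilon))$. -/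

import Mathlib

open Filter Topology

namespace DriftPlusPenalty

/-- The feasible set `{x ∈ ℝⁿ : g_k(x) ≤ 0 for all k}`. -/
def feasible {n m : ℕ} (g : Fin m → EuclideanSpace ℝ (Fin n) → ℝ) :
    Set (EuclideanSpace ℝ (Fin n)) :=
  {x | ∀ k, g k x ≤ 0}

/-- `xs` is an optimal solution of `min f(x)` subject to `g(x) ≤ 0`. -/
def IsSolution {n m : ℕ} (f : EuclideanSpace ℝ (Fin n) → ℝ)
    (g : Fin m → EuclideanSpace ℝ (Fin n) → ℝ) (xs : EuclideanSpace ℝ (Fin n)) : Prop :=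
  xs ∈ feasible g ∧ IsMinOn f (feasible g) xs

/-- A point is `ε`-optimal, relative to the optimal solution `xs`. -/
def IsEpsOptimal {n m : ℕ} (f : EuclideanSpace ℝ (Fin n) → ℝ)
    (g : Fin m → EuclideanSpace ℝ (Fin n) → ℝ) (xs : EuclideanSpace ℝ (Fin n))
    (ε : ℝ) (y : EuclideanSpace ℝ (Fin n)) : Prop :=
  f y ≤ f xs + ε ∧ ∀ k, g k y ≤ ε

/-- The Jacobian of `g` at `x`: row `k` is the gradient of `g_k`. -/
noncomputable def jacobian {n m : ℕ} (g : Fin m → EuclideanSpace ℝ (Fin n) → ℝ)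
    (x : EuclideanSpace ℝ (Fin n)) : Matrix (Fin m) (Fin n) ℝ :=
  Matrix.of fun k i => fderiv ℝ (g k) x (EuclideanSpace.single i 1)

/-- The rows of the Jacobian at `x` that belong to the constraints active at `x`. -/
noncomputable def activeJacobian {n m : ℕ} (g : Fin m → EuclideanSpace ℝ (Fin n) → ℝ)
    (x : EuclideanSpace ℝ (Fin n)) : Matrix {k : Fin m // g k x = 0} (Fin n) ℝ :=
  (jacobian g x).submatrix Subtype.val id

/-- The Frobenius norm of the Jacobian is bounded on `ℝⁿ`. -/
def HasBoundedJacobian {n m : ℕ} (g : Fin m → EuclideanSpace ℝ (Fin n) → ℝ) : Prop :=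
  ∃ c : ℝ, ∀ x, √(∑ k, ∑ i, (jacobian g x k i) ^ 2) ≤ c

/-- The nonnegative orthant `ℝ^m_+`. -/
def orthant (m : ℕ) : Set (EuclideanSpace ℝ (Fin m)) := {l | ∀ k, 0 ≤ l k}

/-- The Lagrangian `f(x) + ∑ₖ λₖ gₖ(x)`. -/
noncomputable def lagrangian {n m : ℕ} (f : EuclideanSpace ℝ (Fin n) → ℝ)
    (g : Fin m → EuclideanSpace ℝ (Fin n) → ℝ) (l : EuclideanSpace ℝ (Fin m))
    (x : EuclideanSpace ℝ (Fin n)) : ℝ :=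
  f x + ∑ k, l k * g k x

/-- The Lagrangian dual function; it is only used on `orthant m`. -/
noncomputable def dual {n m : ℕ} (f : EuclideanSpace ℝ (Fin n) → ℝ)
    (g : Fin m → EuclideanSpace ℝ (Fin n) → ℝ) (l : EuclideanSpace ℝ (Fin m)) : ℝ :=
  ⨅ x, lagrangian f g l x

/-- The infimum defining the dual function is an attained minimum throughout `ℝ^m_+`. -/
def DualWellDefined {n m : ℕ} (f : EuclideanSpace ℝ (Fin n) → ℝ)
    (g : Fin m → EuclideanSpace ℝ (Fin n) → ℝ) : Prop :=
  ∀ l ∈ orthant m, IsLeast (Set.range (lagrangian f g l)) (dual f g l)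

/-- `f` is strongly convex with modulus `α`, each `g_k` is Lipschitz with modulus `β`. -/
def StronglyConvexProgram {n m : ℕ} (f : EuclideanSpace ℝ (Fin n) → ℝ)
    (g : Fin m → EuclideanSpace ℝ (Fin n) → ℝ) (α β : ℝ) : Prop :=
  0 < α ∧ StrongConvexOn Set.univ α f ∧
  0 < β ∧ ∀ k x y, |g k y - g k x| ≤ β * ‖y - x‖

/-- `ls ≥ 0` and `q(ls)` is the optimal value of the program. -/
def IsLagrangeMultiplier {n m : ℕ} (f : EuclideanSpace ℝ (Fin n) → ℝ)
    (g : Fin m → EuclideanSpace ℝ (Fin n) → ℝ) (ls : EuclideanSpace ℝ (Fin m)) : Prop :=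
  ls ∈ orthant m ∧
  IsLeast (Set.range (lagrangian f g ls)) (dual f g ls) ∧
  IsLeast (f '' feasible g) (dual f g ls)

/-- Strong duality: a Lagrange multiplier exists. -/
def StrongDuality {n m : ℕ} (f : EuclideanSpace ℝ (Fin n) → ℝ)
    (g : Fin m → EuclideanSpace ℝ (Fin n) → ℝ) : Prop :=
  ∃ ls, IsLagrangeMultiplier f g ls

/-- The dual function is smooth on `ℝ^m_+` with modulus `γ`: it has a gradient there (relative to
`ℝ^m_+`, hence one-sided on the boundary) which is Lipschitz with modulus `γ`. -/
def SmoothDual {n m : ℕ} (f : EuclideanSpace ℝ (Fin n) → ℝ)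
    (g : Fin m → EuclideanSpace ℝ (Fin n) → ℝ) (γ : ℝ) : Prop :=
  0 < γ ∧ ∃ G : EuclideanSpace ℝ (Fin m) → EuclideanSpace ℝ (Fin m),
    (∀ l ∈ orthant m, HasGradientWithinAt (dual f g) (G l) (orthant m) l) ∧
    ∀ l ∈ orthant m, ∀ l' ∈ orthant m, ‖G l' - G l‖ ≤ γ * ‖l' - l‖

/-- Quadratic decay of the dual function around `ls`, with radius `D` and constant `L`. -/
def IsLocallyQuadraticAt {n m : ℕ} (f : EuclideanSpace ℝ (Fin n) → ℝ)
    (g : Fin m → EuclideanSpace ℝ (Fin n) → ℝ) (ls : EuclideanSpace ℝ (Fin m))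
    (D L : ℝ) : Prop :=
  0 < D ∧ 0 < L ∧ ∀ l ∈ orthant m, ‖l - ls‖ ≤ D →
    dual f g l + L * ‖l - ls‖ ^ 2 ≤ dual f g ls

/-- The dual function is locally quadratic at the Lagrange multiplier(s). -/
def LocallyQuadraticDual {n m : ℕ} (f : EuclideanSpace ℝ (Fin n) → ℝ)
    (g : Fin m → EuclideanSpace ℝ (Fin n) → ℝ) : Prop :=
  ∀ ls, IsLagrangeMultiplier f g ls → ∃ D L, IsLocallyQuadraticAt f g ls D L

/-- Strong concavity, with modulus `L`, of the dual function on the part of `ℝ^m_+` within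
distance `D` of `ls`. -/
def IsLocallyStronglyConcaveAt {n m : ℕ} (f : EuclideanSpace ℝ (Fin n) → ℝ)
    (g : Fin m → EuclideanSpace ℝ (Fin n) → ℝ) (ls : EuclideanSpace ℝ (Fin m))
    (D L : ℝ) : Prop :=
  0 < D ∧ 0 < L ∧ StrongConcaveOn {l | l ∈ orthant m ∧ ‖l - ls‖ ≤ D} L (dual f g)

/-- The dual function is locally strongly concave at the Lagrange multiplier(s). -/
def LocallyStronglyConcaveDual {n m : ℕ} (f : EuclideanSpace ℝ (Fin n) → ℝ)
    (g : Fin m → EuclideanSpace ℝ (Fin n) → ℝ) : Prop :=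
  ∀ ls, IsLagrangeMultiplier f g ls → ∃ D L, IsLocallyStronglyConcaveAt f g ls D L

/-- The drift-plus-penalty algorithm with shifted running averages, with parameter `V` and initial
queues `Q0`: `x` are the primal iterates, `Q` the virtual queues, `xbar` the shifted averages. -/
structure IsShiftedRun {n m : ℕ} (f : EuclideanSpace ℝ (Fin n) → ℝ)
    (g : Fin m → EuclideanSpace ℝ (Fin n) → ℝ) (V : ℝ) (Q0 : EuclideanSpace ℝ (Fin m))
    (x : ℕ → EuclideanSpace ℝ (Fin n)) (Q : ℕ → EuclideanSpace ℝ (Fin m))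
    (xbar : ℕ → EuclideanSpace ℝ (Fin n)) : Prop where
  init : Q 0 = Q0
  argmin : ∀ t, IsMinOn (fun y => V * f y + ∑ k, Q t k * g k y) Set.univ (x t)
  queue : ∀ t k, Q (t + 1) k = max (Q t k + g k (x t)) 0
  avg_even : ∀ t, Even (t + 1) →
    xbar (t + 1) = (((t + 1 : ℕ) : ℝ) / 2)⁻¹ • ∑ τ ∈ Finset.Ico ((t + 1) / 2) (t + 1), x τ
  avg_odd : ∀ t, Odd (t + 1) → xbar (t + 1) = xbar t

/-- For the algorithm started with `V`, `Q0`, the objective error and the constraint violations of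
`xbar t` are `O(r t)`. -/
def ErrorDecaysLike {n m : ℕ} (f : EuclideanSpace ℝ (Fin n) → ℝ)
    (g : Fin m → EuclideanSpace ℝ (Fin n) → ℝ) (xs : EuclideanSpace ℝ (Fin n))
    (V : ℝ) (Q0 : EuclideanSpace ℝ (Fin m)) (r : ℕ → ℝ) : Prop :=
  ∃ C : ℝ, 0 ≤ C ∧ ∃ T : ℕ, ∀ x Q xbar, IsShiftedRun f g V Q0 x Q xbar →
    ∀ t, T ≤ t → f (xbar t) ≤ f xs + C * r t ∧ ∀ k, g k (xbar t) ≤ C * r t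

/-- For the algorithm started with `V`, `Q0`, the convergence time is `O(h ε)` as `ε → 0+`:
`xbar t` is `ε`-optimal for all `t ≥ C * h ε`. -/
def HasConvergenceTime {n m : ℕ} (f : EuclideanSpace ℝ (Fin n) → ℝ)
    (g : Fin m → EuclideanSpace ℝ (Fin n) → ℝ) (xs : EuclideanSpace ℝ (Fin n))
    (V : ℝ) (Q0 : EuclideanSpace ℝ (Fin m)) (h : ℝ → ℝ) : Prop :=
  ∃ C : ℝ, 0 < C ∧ ∀ᶠ ε in 𝓝[>] (0 : ℝ), ∀ x Q xbar, IsShiftedRun f g V Q0 x Q xbar →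
    ∀ t : ℕ, C * h ε ≤ (t : ℝ) → IsEpsOptimal f g xs ε (xbar t)

end DriftPlusPenalty

/-! The scaled queues `V⁻¹ • Q t` perform projected gradient ascent with step `1 / V` on the dual
function `q`: `x t` minimizes the Lagrangian at the scaled queue, `g (x t)` is a supergradient of
`q` there, and truncation at `0` is projection onto the orthant. Strong convexity of `f` and the
Lipschitz bounds on `g` give `q` a quadratic lower bound of curvature `m * β ^ 2 / α ≤ V`
(`dual_ge`). The three-point inequality then yields a dual gap `O(1/t)` and queues that never move
farther from a multiplier than they started.

Local geometry turns gap into distance. If `q` decays quadratically, the distance is `O(1/√t)`; if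
`q` is strongly concave, its square shrinks by `1 - L / V` per step once the queues are close. Over
a window of length `s`, queue increments telescope for the constraints and the drift `‖Q‖ ^ 2`
telescopes for the objective, so both errors are at most a constant times distance divided by `s`
(`IsShiftedRun.error_le`).

The local geometry comes from the rank conditions. They yield KKT multipliers, hence strong duality,
and make the transposed Jacobian injective with a margin. When the multiplier moves by `u`, a step
of the primal point along `-Jᵀu` lowers the Lagrangian by a multiple of `‖u‖ ^ 2`
(`exists_lagrangian_decrease`). Applied at `xs`, this gives quadratic decay; applied at all nearby
minimizers, it gives strong concavity. -/

namespace DriftPlusPenalty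

/-! ### Strong convexity: growth, existence of minimizers, first-order criterion. -/

section StrongConvexity

variable {E : Type*} [NormedAddCommGroup E] [NormedSpace ℝ E]

/-- Dividing the strong convexity inequality by its small weight `s` leaves a factor `1 - s` on the
quadratic term; letting `s → 0` removes it. -/
lemma add_le_of_forall_one_sub_mul {a b c : ℝ}
    (h : ∀ s : ℝ, 0 < s → s < 1 → a + (1 - s) * b ≤ c) : a + b ≤ c := by
  have hc : Continuous fun s : ℝ => a + (1 - s) * b := by fun_prop
  have ht : Tendsto (fun s : ℝ => a + (1 - s) * b) (𝓝[>] 0) (𝓝 (a + b)) := by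
    simpa using (hc.tendsto 0).mono_left nhdsWithin_le_nhds
  refine le_of_tendsto ht ?_
  filter_upwards [Ioo_mem_nhdsGT (zero_lt_one' ℝ)] with s hs
  exact h s hs.1 hs.2

/-- Quadratic growth of a strongly convex function away from a minimizer. -/
lemma StrongConvexOn.growth {h : E → ℝ} {α : ℝ} {s : Set E} (hh : StrongConvexOn s α h)
    {x y : E} (hx : x ∈ s) (hy : y ∈ s) (hmin : IsMinOn h s x) :
    h x + α / 2 * ‖y - x‖ ^ 2 ≤ h y := by
  refine add_le_of_forall_one_sub_mul fun r hr0 hr1 => ?_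
  have h1 := hh.2 hx hy (sub_nonneg.2 hr1.le) hr0.le (by ring)
  have h2 : h x ≤ h ((1 - r) • x + r • y) :=
    hmin (hh.1 hx hy (sub_nonneg.2 hr1.le) hr0.le (by ring))
  rw [norm_sub_rev x y] at h1
  simp only [smul_eq_mul] at h1
  have h3 : r * (h x + (1 - r) * (α / 2 * ‖y - x‖ ^ 2)) ≤ r * h y := by linarith
  exact le_of_mul_le_mul_left h3 hr0

lemma StrongConvexOn.exists_isMinOn [FiniteDimensional ℝ E] {h : E → ℝ} {α : ℝ} (hα : 0 < α)
    (hh : StrongConvexOn Set.univ α h) (hc : Continuous h) : ∃ x, IsMinOn h Set.univ x := by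
  have := FiniteDimensional.proper ℝ E
  obtain ⟨z₀, -, hz₀⟩ := (isCompact_closedBall (0 : E) 1).exists_isMinOn
    ⟨0, by simp⟩ hc.continuousOn
  obtain ⟨x, hx⟩ := hc.exists_forall_le' (0 : E) (by
    rw [Metric.cobounded_eq_cocompact.symm]
    have hev : ∀ᶠ y : E in Bornology.cobounded E, 1 + 2 * (h 0 - h z₀) / α + 1 < ‖y‖ :=
      tendsto_norm_cobounded_atTop.eventually_gt_atTop _
    filter_upwards [hev] with y hy
    by_contra! hlt
    have hz0 : h z₀ ≤ h 0 := hz₀ (by simp)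
    have hfrac : 0 ≤ 2 * (h 0 - h z₀) / α := by
      apply div_nonneg _ hα.le; linarith
    have hy1 : 1 < ‖y‖ := by linarith
    -- The weight `‖y‖⁻¹` puts the combination of `0` and `y` on the unit sphere, where `h z₀` is a
    -- lower bound; strong convexity then bounds `‖y‖` in terms of `h 0 - h z₀`.
    have hs0 : 0 < ‖y‖⁻¹ := by positivity
    have hs1 : ‖y‖⁻¹ ≤ 1 := inv_le_one_of_one_le₀ hy1.le
    have h1 := hh.2 (Set.mem_univ 0) (Set.mem_univ y) (sub_nonneg.2 hs1) hs0.le (by ring)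
    have h2 : h z₀ ≤ h ((1 - ‖y‖⁻¹) • (0 : E) + ‖y‖⁻¹ • y) := by
      apply hz₀
      simp [norm_smul, inv_mul_cancel₀ (by linarith : ‖y‖ ≠ 0)]
    simp only [smul_eq_mul, zero_sub, norm_neg] at h1
    have h3 : (1 - ‖y‖⁻¹) * ‖y‖⁻¹ * (α / 2 * ‖y‖ ^ 2) = α / 2 * (‖y‖ - 1) := by
      field_simp
    rw [h3] at h1
    have h4 : ‖y‖⁻¹ * h y ≤ ‖y‖⁻¹ * h 0 := by gcongr
    have h5 : α / 2 * (‖y‖ - 1) ≤ h 0 - h z₀ := by linarith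
    have h6 : α / 2 * (2 * (h 0 - h z₀) / α) = h 0 - h z₀ := by field_simp
    have h7 : α / 2 * (2 * (h 0 - h z₀) / α) < α / 2 * (‖y‖ - 1) := by
      apply mul_lt_mul_of_pos_left _ (by positivity); linarith
    linarith)
  exact ⟨x, fun y _ => hx y⟩

lemma ConvexOn.isMinOn_of_fderiv_eq_zero {h : E → ℝ} (hh : ConvexOn ℝ Set.univ h) {x : E}
    (hd : HasFDerivAt h (0 : E →L[ℝ] ℝ) x) : IsMinOn h Set.univ x := by
  intro y _
  have hlim := (hd.hasLineDerivAt (y - x)).tendsto_slope_zero_right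
  have : (0 : ℝ) ≤ h y - h x := by
    refine le_of_tendsto hlim ?_
    filter_upwards [Ioo_mem_nhdsGT (zero_lt_one' ℝ)] with s hs
    have h1 := hh.2 (Set.mem_univ x) (Set.mem_univ y) (sub_nonneg.2 hs.2.le) hs.1.le (by ring)
    have h2 : x + s • (y - x) = (1 - s) • x + s • y := by module
    simp only [h2, smul_eq_mul] at h1 ⊢
    rw [inv_mul_le_iff₀ hs.1]
    linarith
  show h x ≤ h y
  linarith

end StrongConvexity

/-! ### The Lagrangian, its minimizers, and concavity and smoothness of the dual. -/

section Lagrangian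

variable {n m : ℕ} {f : EuclideanSpace ℝ (Fin n) → ℝ}
  {g : Fin m → EuclideanSpace ℝ (Fin n) → ℝ} {α β : ℝ}

/-- The vector `(g₁(x), …, gₘ(x))` of constraint values. -/
noncomputable def constraintVec (g : Fin m → EuclideanSpace ℝ (Fin n) → ℝ)
    (x : EuclideanSpace ℝ (Fin n)) : EuclideanSpace ℝ (Fin m) :=
  WithLp.toLp 2 fun k => g k x

@[simp] lemma constraintVec_apply (x : EuclideanSpace ℝ (Fin n)) (k : Fin m) :
    constraintVec g x k = g k x := rfl

lemma inner_eq_sum (u v : EuclideanSpace ℝ (Fin m)) : inner ℝ u v = ∑ k, u k * v k := by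
  simp [PiLp.inner_apply, mul_comm]

lemma lagrangian_eq (l : EuclideanSpace ℝ (Fin m)) (x : EuclideanSpace ℝ (Fin n)) :
    lagrangian f g l x = f x + inner ℝ l (constraintVec g x) := by
  simp [lagrangian, inner_eq_sum]

lemma lagrangian_eq_add (l l' : EuclideanSpace ℝ (Fin m)) (x : EuclideanSpace ℝ (Fin n)) :
    lagrangian f g l' x = lagrangian f g l x + inner ℝ (l' - l) (constraintVec g x) := by
  rw [lagrangian_eq, lagrangian_eq, inner_sub_left]; ring

lemma convex_orthant : Convex ℝ (orthant m) := by
  intro x hx y hy a b ha hb _ k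
  have h1 := mul_nonneg ha (hx k)
  have h2 := mul_nonneg hb (hy k)
  simpa using add_nonneg h1 h2

lemma lagrangian_strongConvexOn (hf : StrongConvexOn Set.univ α f)
    (hg : ∀ k, ConvexOn ℝ Set.univ (g k)) {l : EuclideanSpace ℝ (Fin m)} (hl : l ∈ orthant m) :
    StrongConvexOn Set.univ α (lagrangian f g l) := by
  refine ⟨convex_univ, fun x _ y _ a b ha hb hab => ?_⟩
  have h1 := hf.2 (Set.mem_univ x) (Set.mem_univ y) ha hb hab
  have h2 : ∑ k, l k * g k (a • x + b • y) ≤ a * ∑ k, l k * g k x + b * ∑ k, l k * g k y := by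
    rw [Finset.mul_sum, Finset.mul_sum, ← Finset.sum_add_distrib]
    refine Finset.sum_le_sum fun k _ => ?_
    have := mul_le_mul_of_nonneg_left
      ((hg k).2 (Set.mem_univ x) (Set.mem_univ y) ha hb hab) (hl k)
    simp only [smul_eq_mul] at this
    linarith
  simp only [smul_eq_mul, lagrangian] at h1 ⊢
  linarith

lemma dual_eq {l : EuclideanSpace ℝ (Fin m)} {x : EuclideanSpace ℝ (Fin n)}
    (hx : IsMinOn (lagrangian f g l) Set.univ x) : dual f g l = lagrangian f g l x := by
  have : IsLeast (Set.range (lagrangian f g l)) (lagrangian f g l x) :=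
    ⟨⟨x, rfl⟩, by rintro _ ⟨y, rfl⟩; exact hx (Set.mem_univ y)⟩
  exact this.csInf_eq

lemma isLeast_dual {l : EuclideanSpace ℝ (Fin m)} {x : EuclideanSpace ℝ (Fin n)}
    (hx : IsMinOn (lagrangian f g l) Set.univ x) :
    IsLeast (Set.range (lagrangian f g l)) (dual f g l) := by
  rw [dual_eq hx]
  exact ⟨⟨x, rfl⟩, by rintro _ ⟨y, rfl⟩; exact hx (Set.mem_univ y)⟩

lemma continuous_constraint (hP : StronglyConvexProgram f g α β) (k : Fin m) :
    Continuous (g k) := by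
  have : LipschitzWith β.toNNReal (g k) := LipschitzWith.of_dist_le_mul fun x y => by
    rw [Real.dist_eq, dist_eq_norm, Real.coe_toNNReal _ hP.2.2.1.le]
    exact hP.2.2.2 k y x
  exact this.continuous

lemma exists_isMinOn_lagrangian (hP : StronglyConvexProgram f g α β) (hfc : Continuous f)
    (hg : ∀ k, ConvexOn ℝ Set.univ (g k)) {l : EuclideanSpace ℝ (Fin m)} (hl : l ∈ orthant m) :
    ∃ x, IsMinOn (lagrangian f g l) Set.univ x := by
  refine StrongConvexOn.exists_isMinOn hP.1 (lagrangian_strongConvexOn hP.2.1 hg hl) ?_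
  have := continuous_constraint hP
  unfold lagrangian
  fun_prop

lemma dualWellDefined (hP : StronglyConvexProgram f g α β) (hfc : Continuous f)
    (hg : ∀ k, ConvexOn ℝ Set.univ (g k)) : DualWellDefined f g := fun _ hl =>
  let ⟨_, hx⟩ := exists_isMinOn_lagrangian hP hfc hg hl
  isLeast_dual hx

lemma dual_le_lagrangian (hD : DualWellDefined f g) {l : EuclideanSpace ℝ (Fin m)}
    (hl : l ∈ orthant m) (x : EuclideanSpace ℝ (Fin n)) : dual f g l ≤ lagrangian f g l x :=
  (hD l hl).2 ⟨x, rfl⟩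

/-- The constraint values at a minimizer of the Lagrangian form a supergradient of the dual. -/
lemma dual_le_add_inner (hD : DualWellDefined f g) {l l' : EuclideanSpace ℝ (Fin m)}
    (hl' : l' ∈ orthant m) {x : EuclideanSpace ℝ (Fin n)}
    (hx : IsMinOn (lagrangian f g l) Set.univ x) :
    dual f g l' ≤ dual f g l + inner ℝ (l' - l) (constraintVec g x) := by
  rw [dual_eq hx, ← lagrangian_eq_add]
  exact dual_le_lagrangian hD hl' x

lemma concaveOn_dual (hD : DualWellDefined f g) : ConcaveOn ℝ (orthant m) (dual f g) := by
  refine ⟨convex_orthant, fun u hu v hv a b ha hb hab => ?_⟩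
  obtain ⟨x, hx⟩ := (hD _ (convex_orthant hu hv ha hb hab)).1
  have h1 := mul_le_mul_of_nonneg_left (dual_le_lagrangian hD hu x) ha
  have h2 := mul_le_mul_of_nonneg_left (dual_le_lagrangian hD hv x) hb
  rw [← hx]
  simp only [lagrangian_eq, inner_add_left, inner_smul_left, smul_eq_mul] at *
  simp only [conj_trivial]
  have h3 : f x = a * f x + b * f x := by rw [← add_mul, hab, one_mul]
  linarith

lemma norm_constraintVec_sub_le (hP : StronglyConvexProgram f g α β)
    (x y : EuclideanSpace ℝ (Fin n)) :
    ‖constraintVec g y - constraintVec g x‖ ≤ √m * β * ‖y - x‖ := by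
  have hβ := hP.2.2.1
  rw [EuclideanSpace.norm_eq]
  apply Real.sqrt_le_iff.2 ⟨by positivity, ?_⟩
  calc ∑ k, ‖(constraintVec g y - constraintVec g x) k‖ ^ 2
      ≤ ∑ _k : Fin m, (β * ‖y - x‖) ^ 2 := by
        refine Finset.sum_le_sum fun k _ => ?_
        gcongr
        exact hP.2.2.2 k x y
    _ = (√m * β * ‖y - x‖) ^ 2 := by
        rw [Finset.sum_const, Finset.card_univ, Fintype.card_fin, nsmul_eq_mul, mul_pow, mul_pow,
          mul_pow, Real.sq_sqrt (Nat.cast_nonneg m)]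
        ring

/-- Minimizers of the Lagrangian depend on the multiplier in a Lipschitz way. -/
lemma norm_argmin_sub_le (hP : StronglyConvexProgram f g α β)
    (hg : ∀ k, ConvexOn ℝ Set.univ (g k)) {l l' : EuclideanSpace ℝ (Fin m)}
    (hl : l ∈ orthant m) (hl' : l' ∈ orthant m) {x x' : EuclideanSpace ℝ (Fin n)}
    (hx : IsMinOn (lagrangian f g l) Set.univ x) (hx' : IsMinOn (lagrangian f g l') Set.univ x') :
    ‖x' - x‖ ≤ √m * β / α * ‖l' - l‖ := by
  have hα := hP.1
  have hβ := hP.2.2.1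
  -- Adding the growth inequalities of the two Lagrangians at each other's minimizers gives `α ‖x' -
  -- x‖² ≤ ⟪l' - l, g x - g x'⟫`.
  have h1 := StrongConvexOn.growth (lagrangian_strongConvexOn hP.2.1 hg hl)
    (Set.mem_univ x) (Set.mem_univ x') hx
  have h2 := StrongConvexOn.growth (lagrangian_strongConvexOn hP.2.1 hg hl')
    (Set.mem_univ x') (Set.mem_univ x) hx'
  rw [lagrangian_eq_add l l' x, lagrangian_eq_add l l' x', norm_sub_rev x x'] at h2
  have h3 : inner ℝ (l' - l) (constraintVec g x - constraintVec g x')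
      ≤ ‖l' - l‖ * (√m * β * ‖x' - x‖) := by
    refine (real_inner_le_norm _ _).trans ?_
    gcongr
    rw [norm_sub_rev x' x]
    exact norm_constraintVec_sub_le hP x' x
  rw [inner_sub_right] at h3
  have h4 : ‖x' - x‖ * (α * ‖x' - x‖) ≤ ‖x' - x‖ * (√m * β * ‖l' - l‖) := by nlinarith
  rcases (norm_nonneg (x' - x)).eq_or_lt with h0 | h0
  · rw [← h0]; positivity
  · have := le_of_mul_le_mul_left h4 h0
    rw [div_mul_eq_mul_div, le_div_iff₀ hα]
    linarith

/-- The lower quadratic bound that makes the dual function smooth. -/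
lemma dual_ge (hP : StronglyConvexProgram f g α β)
    (hg : ∀ k, ConvexOn ℝ Set.univ (g k)) (hD : DualWellDefined f g) {V : ℝ}
    (hV : m * β ^ 2 / α ≤ V) {l l' : EuclideanSpace ℝ (Fin m)}
    (hl : l ∈ orthant m) (hl' : l' ∈ orthant m) {x : EuclideanSpace ℝ (Fin n)}
    (hx : IsMinOn (lagrangian f g l) Set.univ x) :
    dual f g l + inner ℝ (l' - l) (constraintVec g x) - V / 2 * ‖l' - l‖ ^ 2 ≤ dual f g l' := by
  have hα := hP.1
  have hβ := hP.2.2.1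
  obtain ⟨x', hx'⟩ := (hD l' hl').1
  have h1 := StrongConvexOn.growth (lagrangian_strongConvexOn hP.2.1 hg hl)
    (Set.mem_univ x) (Set.mem_univ x') hx
  rw [← hx', lagrangian_eq_add l l', dual_eq hx]
  have h3 : inner ℝ (l' - l) (constraintVec g x - constraintVec g x')
      ≤ ‖l' - l‖ * (√m * β * ‖x' - x‖) := by
    refine (real_inner_le_norm _ _).trans ?_
    gcongr
    rw [norm_sub_rev x' x]
    exact norm_constraintVec_sub_le hP x' x
  rw [inner_sub_right] at h3
  have h4 : ‖l' - l‖ * (√m * β * ‖x' - x‖)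
      ≤ α / 2 * ‖x' - x‖ ^ 2 + m * β ^ 2 / α / 2 * ‖l' - l‖ ^ 2 := by
    have hsq : (√(m : ℝ)) ^ 2 = m := Real.sq_sqrt (Nat.cast_nonneg m)
    -- Completing the square: the growth term `α / 2 * ‖x' - x‖ ^ 2` absorbs the cross term and
    -- leaves the curvature `m * β ^ 2 / α`.
    have h5 : 0 ≤ α / 2 * (‖x' - x‖ - √m * β / α * ‖l' - l‖) ^ 2 := by positivity
    have h6 : α / 2 * (‖x' - x‖ - √m * β / α * ‖l' - l‖) ^ 2 = α / 2 * ‖x' - x‖ ^ 2 +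
        (√m) ^ 2 * β ^ 2 / α / 2 * ‖l' - l‖ ^ 2 - ‖l' - l‖ * (√m * β * ‖x' - x‖) := by
      field_simp; ring
    rw [h6, hsq] at h5
    linarith
  have h7 : m * β ^ 2 / α / 2 * ‖l' - l‖ ^ 2 ≤ V / 2 * ‖l' - l‖ ^ 2 := by gcongr
  linarith

/-- The gradient is the constraint vector at the minimizer: `q` lies between the affine
supergradient bound and that bound minus a quadratic. Its Lipschitz estimate composes those of `g`
and of the minimizer. -/
lemma exists_smoothDual (hP : StronglyConvexProgram f g α β) (hfc : Continuous f)
    (hg : ∀ k, ConvexOn ℝ Set.univ (g k)) : ∃ γ, SmoothDual f g γ := by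
  have hα := hP.1
  have hβ := hP.2.2.1
  have hD := dualWellDefined hP hfc hg
  have hex : ∀ l, ∃ x, l ∈ orthant m → IsMinOn (lagrangian f g l) Set.univ x := fun l => by
    by_cases hl : l ∈ orthant m
    · exact (exists_isMinOn_lagrangian hP hfc hg hl).imp fun _ h _ => h
    · exact ⟨0, fun h => absurd h hl⟩
  choose X hX using hex
  -- The `+ 1` keeps the modulus positive when `m = 0`.
  refine ⟨m * β ^ 2 / α + 1, by positivity, fun l => constraintVec g (X l), fun l hl => ?_,
    fun l hl l' hl' => ?_⟩
  · rw [hasGradientWithinAt_iff_isLittleO]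
    have hO : (fun l' => dual f g l' - dual f g l - inner ℝ (constraintVec g (X l)) (l' - l))
        =O[𝓝[orthant m] l] fun l' => ‖l' - l‖ ^ 2 := by
      refine Asymptotics.IsBigO.of_bound (m * β ^ 2 / α / 2) ?_
      filter_upwards [self_mem_nhdsWithin] with l' hl'
      have h1 := dual_le_add_inner hD hl' (hX l hl)
      have h2 := dual_ge hP hg hD le_rfl hl hl' (hX l hl)
      rw [real_inner_comm, Real.norm_eq_abs, Real.norm_eq_abs, abs_of_nonneg (sq_nonneg ‖l' - l‖),
        abs_le]
      have : 0 ≤ m * β ^ 2 / α / 2 * ‖l' - l‖ ^ 2 := by positivity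
      constructor <;> linarith
    refine hO.trans_isLittleO ?_
    have h0 : Tendsto (fun l' => l' - l) (𝓝[orthant m] l) (𝓝 0) := by
      have : Continuous fun l' : EuclideanSpace ℝ (Fin m) => l' - l := by fun_prop
      simpa using (this.tendsto l).mono_left nhdsWithin_le_nhds
    exact (Asymptotics.isLittleO_norm_pow_id one_lt_two).comp_tendsto h0
  · calc ‖constraintVec g (X l') - constraintVec g (X l)‖
        ≤ √m * β * (√m * β / α * ‖l' - l‖) :=
          (norm_constraintVec_sub_le hP _ _).trans (by
            gcongr; exact norm_argmin_sub_le hP hg hl hl' (hX l hl) (hX l' hl'))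
      _ = (√m) ^ 2 * β ^ 2 / α * ‖l' - l‖ := by ring
      _ = m * β ^ 2 / α * ‖l' - l‖ := by rw [Real.sq_sqrt (Nat.cast_nonneg m)]
      _ ≤ (m * β ^ 2 / α + 1) * ‖l' - l‖ := by gcongr; linarith

lemma exists_stronglyConvexProgram (hf_sc : ∃ α : ℝ, 0 < α ∧ StrongConvexOn Set.univ α f)
    (hg_lip : ∀ k, ∃ β : ℝ, 0 < β ∧ ∀ x y, |g k y - g k x| ≤ β * ‖y - x‖) :
    ∃ α β, StronglyConvexProgram f g α β := by
  obtain ⟨α, hα, hf⟩ := hf_sc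
  choose β hβ hb using hg_lip
  refine ⟨α, 1 + ∑ k, β k, hα, hf, ?_, fun k x y => (hb k x y).trans ?_⟩
  · exact add_pos_of_pos_of_nonneg one_pos (Finset.sum_nonneg fun k _ => (hβ k).le)
  · gcongr
    have := Finset.single_le_sum (fun k _ => (hβ k).le) (Finset.mem_univ k)
    linarith

end Lagrangian

end DriftPlusPenalty

namespace DriftPlusPenalty

/-! ### Constraint qualification, KKT multipliers and strong duality. -/

section KKT

variable {n m : ℕ} {f : EuclideanSpace ℝ (Fin n) → ℝ}
  {g : Fin m → EuclideanSpace ℝ (Fin n) → ℝ} {xs : EuclideanSpace ℝ (Fin n)} {α β : ℝ}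

lemma Matrix.mulVec_surjective_of_rank_eq {ι κ : Type*} [Fintype ι] [Fintype κ]
    {A : Matrix ι κ ℝ} (h : A.rank = Fintype.card ι) (b : ι → ℝ) : ∃ v, A.mulVec v = b := by
  have hr : LinearMap.range A.mulVecLin = ⊤ := by
    apply Submodule.eq_top_of_finrank_eq
    rw [Module.finrank_pi]
    exact h
  obtain ⟨v, hv⟩ := LinearMap.range_eq_top.1 hr b
  exact ⟨v, hv⟩

lemma jacobian_mulVec (x : EuclideanSpace ℝ (Fin n)) (v : Fin n → ℝ) (k : Fin m) :
    (jacobian g x).mulVec v k = fderiv ℝ (g k) x (WithLp.toLp 2 v) := by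
  have : (WithLp.toLp 2 v : EuclideanSpace ℝ (Fin n))
      = ∑ i, v i • EuclideanSpace.single i (1 : ℝ) := by
    ext j
    simp [Finset.sum_apply, Pi.single_apply]
  rw [this, map_sum]
  simp [Matrix.mulVec, dotProduct, jacobian, mul_comm]

/-- Full row rank is used only in this form: the directional derivatives of the active constraints
can be prescribed at will. -/
lemma exists_fderiv_eq_of_rank_activeJacobian
    (h : (activeJacobian g xs).rank = Nat.card {k : Fin m // g k xs = 0}) (b : Fin m → ℝ) :
    ∃ d, ∀ k, g k xs = 0 → fderiv ℝ (g k) xs d = b k := by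
  classical
  obtain ⟨v, hv⟩ := Matrix.mulVec_surjective_of_rank_eq (h.trans Nat.card_eq_fintype_card)
    fun k => b k
  refine ⟨WithLp.toLp 2 v, fun k hk => ?_⟩
  rw [← jacobian_mulVec]
  exact congrFun hv ⟨k, hk⟩

lemma exists_fderiv_eq_of_rank_jacobian (h : (jacobian g xs).rank = m) (b : Fin m → ℝ) :
    ∃ d, ∀ k, fderiv ℝ (g k) xs d = b k := by
  obtain ⟨v, hv⟩ := Matrix.mulVec_surjective_of_rank_eq (h.trans (Fintype.card_fin m).symm) b
  refine ⟨WithLp.toLp 2 v, fun k => ?_⟩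
  rw [← jacobian_mulVec, hv]

/-- Under a linear independence qualification, the objective does not decrease to first order along
the directions that do not increase the active constraints. -/
lemma fderiv_nonneg_of_isSolution (hxs : IsSolution f g xs) (hf : DifferentiableAt ℝ f xs)
    (hg : ∀ k, DifferentiableAt ℝ (g k) xs)
    (hsurj : ∀ b : Fin m → ℝ, ∃ d, ∀ k, g k xs = 0 → fderiv ℝ (g k) xs d = b k)
    {d : EuclideanSpace ℝ (Fin n)} (hd : ∀ k, g k xs = 0 → fderiv ℝ (g k) xs d ≤ 0) :
    0 ≤ fderiv ℝ f xs d := by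
  -- Along `d₀` every active constraint strictly decreases, so tilting `d` by `ε • d₀` gives a
  -- genuinely feasible direction; `ε → 0` recovers `d`.
  obtain ⟨d₀, hd₀⟩ := hsurj fun _ => -1
  have key : ∀ ε : ℝ, 0 < ε → 0 ≤ fderiv ℝ f xs (d + ε • d₀) := by
    intro ε hε
    set e := d + ε • d₀ with he
    have hfeas : ∀ k, ∀ᶠ s : ℝ in 𝓝[>] 0, g k (xs + s • e) ≤ 0 := by
      intro k
      by_cases hk : g k xs = 0
      · have hneg : fderiv ℝ (g k) xs e < 0 := by
          have h1 := hd k hk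
          have h2 := hd₀ k hk
          rw [he, map_add, map_smul, h2]
          simp only [smul_eq_mul]
          linarith
        have hlim := ((hg k).hasFDerivAt.hasLineDerivAt e).tendsto_slope_zero_right
        filter_upwards [hlim.eventually_lt_const hneg, self_mem_nhdsWithin] with s hs hs0
        rw [hk, sub_zero, smul_eq_mul] at hs
        have hs0' : (0 : ℝ) < s := hs0
        by_contra! hpos
        exact absurd hs (not_lt.2 (by positivity))
      · have hlt : g k xs < 0 := lt_of_le_of_ne (hxs.1 k) hk
        have hline : Continuous fun s : ℝ => xs + s • e := by fun_prop
        have hlim : Tendsto (fun s : ℝ => g k (xs + s • e)) (𝓝[>] 0) (𝓝 (g k xs)) := by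
          refine (hg k).continuousAt.tendsto.comp ?_
          simpa using (hline.tendsto 0).mono_left nhdsWithin_le_nhds
        filter_upwards [hlim.eventually_lt_const hlt] with s hs
        exact hs.le
    have hlim := (hf.hasFDerivAt.hasLineDerivAt e).tendsto_slope_zero_right
    refine ge_of_tendsto hlim ?_
    filter_upwards [eventually_all.2 hfeas, self_mem_nhdsWithin] with s hs hs0
    have hs0' : (0 : ℝ) < s := hs0
    have : f xs ≤ f (xs + s • e) := hxs.2 hs
    exact smul_nonneg (by positivity) (sub_nonneg.2 this)
  have hlin : Continuous fun ε : ℝ => fderiv ℝ f xs (d + ε • d₀) := by fun_prop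
  have hlim : Tendsto (fun ε : ℝ => fderiv ℝ f xs (d + ε • d₀)) (𝓝[>] 0)
      (𝓝 (fderiv ℝ f xs d)) := by
    simpa using (hlin.tendsto 0).mono_left nhdsWithin_le_nhds
  refine ge_of_tendsto hlim ?_
  filter_upwards [self_mem_nhdsWithin] with ε hε
  exact key ε hε

/-- Karush–Kuhn–Tucker multipliers exist under a linear independence qualification. -/
lemma exists_kkt_multiplier (hxs : IsSolution f g xs) (hf : DifferentiableAt ℝ f xs)
    (hg : ∀ k, DifferentiableAt ℝ (g k) xs)
    (hsurj : ∀ b : Fin m → ℝ, ∃ d, ∀ k, g k xs = 0 → fderiv ℝ (g k) xs d = b k) :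
    ∃ l ∈ orthant m, (∀ k, l k * g k xs = 0) ∧
      ∀ v, fderiv ℝ f xs v + ∑ k, l k * fderiv ℝ (g k) xs v = 0 := by
  classical
  -- Directions dual, up to sign, to the active gradients: the multiplier of an active constraint is
  -- the derivative of `f` along its own direction.
  choose d hd using fun j : Fin m => hsurj fun k => if k = j then -1 else 0
  let l : EuclideanSpace ℝ (Fin m) :=
    WithLp.toLp 2 fun k => if g k xs = 0 then fderiv ℝ f xs (d k) else 0
  have hl : ∀ k, l k = if g k xs = 0 then fderiv ℝ f xs (d k) else 0 := fun _ => rfl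
  refine ⟨l, fun k => ?_, fun k => ?_, fun v => ?_⟩
  · rw [hl]
    split_ifs with hk
    · refine fderiv_nonneg_of_isSolution hxs hf hg hsurj fun j hj => ?_
      rw [hd k j hj]
      split_ifs <;> norm_num
    · exact le_rfl
  · rw [hl]
    split_ifs with hk
    · rw [hk, mul_zero]
    · rw [zero_mul]
  -- `w` is `v` corrected into the common kernel of the active derivatives. Both `w` and `-w` are
  -- admissible, so `f` is stationary along `w`, and expanding gives the KKT equation for `v`.
  · let w := v + ∑ k, (if g k xs = 0 then fderiv ℝ (g k) xs v else 0) • d k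
    have hw : ∀ j, g j xs = 0 → fderiv ℝ (g j) xs w = 0 := by
      intro j hj
      simp only [w, map_add, map_sum, map_smul, smul_eq_mul, hd _ j hj]
      simp [hj]
    have h1 := fderiv_nonneg_of_isSolution hxs hf hg hsurj (d := w) fun j hj => (hw j hj).le
    have h2 := fderiv_nonneg_of_isSolution hxs hf hg hsurj (d := -w)
      fun j hj => by rw [map_neg, hw j hj, neg_zero]
    rw [map_neg] at h2
    have h3 : fderiv ℝ f xs w = fderiv ℝ f xs v + ∑ k, l k * fderiv ℝ (g k) xs v := by
      simp only [w, map_add, map_sum, map_smul, smul_eq_mul, hl]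
      congr 1
      refine Finset.sum_congr rfl fun k _ => ?_
      split_ifs <;> ring
    linarith

lemma hasFDerivAt_lagrangian {x : EuclideanSpace ℝ (Fin n)} (hf : DifferentiableAt ℝ f x)
    (hg : ∀ k, DifferentiableAt ℝ (g k) x) (l : EuclideanSpace ℝ (Fin m)) :
    HasFDerivAt (lagrangian f g l) (fderiv ℝ f x + ∑ k, l k • fderiv ℝ (g k) x) x := by
  have h := hf.hasFDerivAt.add (HasFDerivAt.fun_sum fun k (_ : k ∈ Finset.univ) =>
    (hg k).hasFDerivAt.const_mul (l k))
  exact h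

/-- For a KKT multiplier, `xs` is a critical point of a convex Lagrangian, hence a global minimizer,
and complementary slackness makes its value `f xs`. -/
lemma strongDuality_of_surjective (hP : StronglyConvexProgram f g α β)
    (hgc : ∀ k, ConvexOn ℝ Set.univ (g k)) (hxs : IsSolution f g xs)
    (hf : DifferentiableAt ℝ f xs) (hg : ∀ k, DifferentiableAt ℝ (g k) xs)
    (hsurj : ∀ b : Fin m → ℝ, ∃ d, ∀ k, g k xs = 0 → fderiv ℝ (g k) xs d = b k) :
    StrongDuality f g := by
  obtain ⟨l, hl, hcs, hst⟩ := exists_kkt_multiplier hxs hf hg hsurj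
  have hd := hasFDerivAt_lagrangian hf hg l
  have h0 : fderiv ℝ f xs + ∑ k, l k • fderiv ℝ (g k) xs = 0 := by
    ext1 v
    simpa using hst v
  rw [h0] at hd
  have hmin := ConvexOn.isMinOn_of_fderiv_eq_zero
    ((lagrangian_strongConvexOn hP.2.1 hgc hl).mono hP.1.le |> strongConvexOn_zero.1) hd
  refine ⟨l, hl, isLeast_dual hmin, ?_⟩
  rw [dual_eq hmin, lagrangian, Finset.sum_eq_zero fun k _ => hcs k, add_zero]
  exact ⟨⟨xs, hxs.1, rfl⟩, by rintro _ ⟨y, hy, rfl⟩; exact hxs.2 hy⟩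

/-- What it means to be a Lagrange multiplier, relative to the optimal solution. -/
lemma IsLagrangeMultiplier.dual_eq_and_isMinOn {ls : EuclideanSpace ℝ (Fin m)}
    (hls : IsLagrangeMultiplier f g ls) (hxs : IsSolution f g xs) :
    dual f g ls = f xs ∧ IsMinOn (lagrangian f g ls) Set.univ xs ∧ ∀ k, ls k * g k xs = 0 := by
  obtain ⟨hpos, hleast, hval⟩ := hls
  have h1 : IsLeast (f '' feasible g) (f xs) :=
    ⟨⟨xs, hxs.1, rfl⟩, by rintro _ ⟨y, hy, rfl⟩; exact hxs.2 hy⟩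
  have hq : dual f g ls = f xs := hval.unique h1
  have hterm : ∀ k ∈ Finset.univ, ls k * g k xs ≤ 0 := fun k _ =>
    mul_nonpos_of_nonneg_of_nonpos (hpos k) (hxs.1 k)
  have h2 : dual f g ls ≤ lagrangian f g ls xs := hleast.2 ⟨xs, rfl⟩
  have h3 : ∑ k, ls k * g k xs ≤ 0 := Finset.sum_nonpos hterm
  -- Since `f xs = q(ls) ≤ f xs + ∑ k, ls k * g k xs ≤ f xs`, the nonpositive terms must all vanish.
  have h4 : ∑ k, ls k * g k xs = 0 := by
    rw [hq, lagrangian] at h2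
    linarith
  refine ⟨hq, fun y _ => ?_, fun k => (Finset.sum_eq_zero_iff_of_nonpos hterm).1 h4 k
    (Finset.mem_univ k)⟩
  show lagrangian f g ls xs ≤ lagrangian f g ls y
  have h5 : lagrangian f g ls xs = dual f g ls := by rw [hq, lagrangian, h4, add_zero]
  rw [h5]
  exact hleast.2 ⟨y, rfl⟩

end KKT

end DriftPlusPenalty

namespace DriftPlusPenalty

/-! ### Local curvature of the dual from the rank conditions. -/

section LocalCurvature

/-- The derivative of a C² function is locally Lipschitz, and the mean value inequality on the
segment turns this into a quadratic remainder. Stating it for all small `r` lets finitely many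
functions share one radius. -/
lemma exists_quadratic_remainder_bound {E : Type*} [NormedAddCommGroup E] [NormedSpace ℝ E]
    {h : E → ℝ} (hh : ContDiff ℝ 2 h) (x₀ : E) :
    ∃ M : ℝ, 0 ≤ M ∧ ∀ᶠ r : ℝ in 𝓝[>] 0, ∀ x ∈ Metric.ball x₀ r, ∀ y ∈ Metric.ball x₀ r,
      |h y - h x - fderiv ℝ h x (y - x)| ≤ M * ‖y - x‖ ^ 2 ∧
      ‖fderiv ℝ h y - fderiv ℝ h x‖ ≤ M * ‖y - x‖ := by
  have hd : ContDiff ℝ 1 (fderiv ℝ h) := hh.fderiv_right (by norm_num)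
  obtain ⟨K, t, ht, hK⟩ := hd.contDiffAt (x := x₀) |>.exists_lipschitzOnWith
  obtain ⟨r₀, hr₀, hball⟩ := Metric.mem_nhds_iff.1 ht
  refine ⟨K, K.2, ?_⟩
  filter_upwards [Ioo_mem_nhdsGT hr₀] with r hr x hx y hy
  have hsub : Metric.ball x₀ r ⊆ t := (Metric.ball_subset_ball hr.2.le).trans hball
  have hLip : ∀ a ∈ Metric.ball x₀ r, ∀ b ∈ Metric.ball x₀ r,
      ‖fderiv ℝ h b - fderiv ℝ h a‖ ≤ K * ‖b - a‖ := fun a ha b hb => by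
    simpa [dist_eq_norm] using hK.dist_le_mul b (hsub hb) a (hsub ha)
  refine ⟨?_, hLip x hx y hy⟩
  have hseg : segment ℝ x y ⊆ Metric.ball x₀ r := (convex_ball x₀ r).segment_subset hx hy
  have hdiff : Differentiable ℝ h := hh.differentiable (by norm_num)
  have := Convex.norm_image_sub_le_of_norm_hasFDerivWithin_le' (f := h) (f' := fderiv ℝ h)
    (φ := fderiv ℝ h x) (C := K * ‖y - x‖) (s := segment ℝ x y)
    (fun z _ => (hdiff z).hasFDerivAt.hasFDerivWithinAt)
    (fun z hz => (hLip x hx z (hseg hz)).trans (by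
      gcongr
      obtain ⟨a, b, ha, hb, hab, rfl⟩ := hz
      have e : a • x + b • y - x = b • (y - x) := by
        have : a = 1 - b := by linarith
        subst this; module
      rw [e, norm_smul, Real.norm_of_nonneg hb]
      exact mul_le_of_le_one_left (norm_nonneg _) (by linarith)))
    (convex_segment x y) (left_mem_segment ℝ x y) (right_mem_segment ℝ x y)
  rw [Real.norm_eq_abs] at this
  linarith

variable {n m : ℕ} {f : EuclideanSpace ℝ (Fin n) → ℝ}
  {g : Fin m → EuclideanSpace ℝ (Fin n) → ℝ} {xs : EuclideanSpace ℝ (Fin n)} {α β : ℝ}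

/-- The combination `∑ₖ uₖ ∇gₖ(x)`, that is, the transposed Jacobian applied to `u`. -/
noncomputable def gradientComb (g : Fin m → EuclideanSpace ℝ (Fin n) → ℝ)
    (x : EuclideanSpace ℝ (Fin n)) (u : EuclideanSpace ℝ (Fin m)) : EuclideanSpace ℝ (Fin n) :=
  ∑ k, u k • gradient (g k) x

lemma inner_gradientComb (x v : EuclideanSpace ℝ (Fin n)) (u : EuclideanSpace ℝ (Fin m)) :
    inner ℝ (gradientComb g x u) v = ∑ k, u k * fderiv ℝ (g k) x v := by
  simp [gradientComb, sum_inner, inner_smul_left, inner_gradient_left]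

lemma norm_sum_smul_le {E : Type*} [NormedAddCommGroup E] [NormedSpace ℝ E]
    (u : EuclideanSpace ℝ (Fin m)) {v : Fin m → E} {c : ℝ} (hv : ∀ k, ‖v k‖ ≤ c) :
    ‖∑ k, u k • v k‖ ≤ m * c * ‖u‖ := by
  calc ‖∑ k, u k • v k‖ ≤ ∑ k, ‖u k • v k‖ := norm_sum_le _ _
    _ ≤ ∑ _k : Fin m, ‖u‖ * c := by
        refine Finset.sum_le_sum fun k _ => ?_
        rw [norm_smul]
        gcongr
        · exact PiLp.norm_apply_le u k
        · exact hv k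
    _ = m * c * ‖u‖ := by simp; ring

lemma norm_gradient_sub {h : EuclideanSpace ℝ (Fin n) → ℝ} (x y : EuclideanSpace ℝ (Fin n)) :
    ‖gradient h y - gradient h x‖ = ‖fderiv ℝ h y - fderiv ℝ h x‖ := by
  rw [← toDual_gradient, ← toDual_gradient, ← map_sub, LinearIsometryEquiv.norm_map]

lemma norm_gradient_le (hP : StronglyConvexProgram f g α β) (k : Fin m)
    (x : EuclideanSpace ℝ (Fin n)) : ‖gradient (g k) x‖ ≤ β := by
  have hL : LipschitzWith β.toNNReal (g k) := LipschitzWith.of_dist_le_mul fun x y => by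
    rw [Real.dist_eq, dist_eq_norm, Real.coe_toNNReal _ hP.2.2.1.le]
    exact hP.2.2.2 k y x
  have := norm_fderiv_le_of_lipschitz ℝ hL (x₀ := x)
  rwa [← toDual_gradient, LinearIsometryEquiv.norm_map, Real.coe_toNNReal _ hP.2.2.1.le] at this

/-- Quantitative injectivity of the transposed Jacobian, from surjectivity of the Jacobian. -/
lemma exists_le_norm_gradientComb {P : Fin m → Prop}
    (hsurj : ∀ b : Fin m → ℝ, ∃ d, ∀ k, P k → fderiv ℝ (g k) xs d = b k) :
    ∃ c : ℝ, 0 < c ∧ ∀ u : EuclideanSpace ℝ (Fin m), (∀ k, ¬ P k → u k = 0) →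
      c * ‖u‖ ≤ ‖gradientComb g xs u‖ := by
  classical
  -- Pairing `gradientComb g xs u` with the dual direction `d j` reads off the coordinate `u j`.
  choose d hd using fun j : Fin m => hsurj fun k => if k = j then 1 else 0
  have hS : 0 ≤ ∑ j, ‖d j‖ := Finset.sum_nonneg fun j _ => norm_nonneg _
  refine ⟨(1 + ∑ j, ‖d j‖)⁻¹, by positivity, fun u hu => ?_⟩
  rw [inv_mul_le_iff₀ (by positivity)]
  have hcoord : ∀ j, |u j| ≤ ‖gradientComb g xs u‖ * ‖d j‖ := by
    intro j
    by_cases hj : P j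
    · have h1 : inner ℝ (gradientComb g xs u) (d j) = u j := by
        rw [inner_gradientComb, Finset.sum_eq_single j]
        · rw [hd j j hj]; simp
        · intro k _ hkj
          by_cases hk : P k
          · rw [hd j k hk, if_neg hkj, mul_zero]
          · rw [hu k hk, zero_mul]
        · simp
      rw [← h1]
      exact abs_real_inner_le_norm _ _
    · rw [hu j hj, abs_zero]; positivity
  have hsum : ‖u‖ ≤ ∑ j, |u j| := by
    have hu' : u = ∑ j, u j • EuclideanSpace.single j (1 : ℝ) := by
      ext i; simp [Pi.single_apply]
    calc ‖u‖ = ‖∑ j, u j • EuclideanSpace.single j (1 : ℝ)‖ := by rw [← hu']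
      _ ≤ ∑ j, ‖u j • EuclideanSpace.single j (1 : ℝ)‖ := norm_sum_le _ _
      _ = ∑ j, |u j| := by simp [norm_smul]
  calc ‖u‖ ≤ ∑ j, |u j| := hsum
    _ ≤ ∑ j, ‖gradientComb g xs u‖ * ‖d j‖ := Finset.sum_le_sum fun j _ => hcoord j
    _ = (∑ j, ‖d j‖) * ‖gradientComb g xs u‖ := by rw [← Finset.mul_sum, mul_comm]
    _ ≤ (1 + ∑ j, ‖d j‖) * ‖gradientComb g xs u‖ := by gcongr; linarith

lemma exists_uniform_remainder_bound (hf : ContDiff ℝ 2 f) (hg : ∀ k, ContDiff ℝ 2 (g k))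
    (xs : EuclideanSpace ℝ (Fin n)) :
    ∃ M r : ℝ, 0 < M ∧ 0 < r ∧ ∀ x ∈ Metric.ball xs r, ∀ y ∈ Metric.ball xs r,
      |f y - f x - fderiv ℝ f x (y - x)| ≤ M * ‖y - x‖ ^ 2 ∧
      ∀ k, |g k y - g k x - fderiv ℝ (g k) x (y - x)| ≤ M * ‖y - x‖ ^ 2 ∧
        ‖fderiv ℝ (g k) y - fderiv ℝ (g k) x‖ ≤ M * ‖y - x‖ := by
  obtain ⟨M₀, hM₀, h₀⟩ := exists_quadratic_remainder_bound hf xs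
  choose M hM h using fun k => exists_quadratic_remainder_bound (hg k) xs
  obtain ⟨r, ⟨hr₀, hrk⟩, hr⟩ :=
    ((h₀.and (eventually_all.2 h)).and (self_mem_nhdsWithin : Set.Ioi (0 : ℝ) ∈ 𝓝[>] 0)).exists
  have hS : 0 ≤ ∑ k, M k := Finset.sum_nonneg fun k _ => hM k
  refine ⟨1 + M₀ + ∑ k, M k, r, by positivity, hr, fun x hx y hy => ⟨?_, fun k => ?_⟩⟩
  · refine (hr₀ x hx y hy).1.trans ?_
    gcongr
    linarith
  · have hk : M k ≤ 1 + M₀ + ∑ k, M k := by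
      have := Finset.single_le_sum (fun k _ => hM k) (Finset.mem_univ k)
      linarith
    obtain ⟨h1, h2⟩ := hrk k x hx y hy
    exact ⟨h1.trans (by gcongr), h2.trans (by gcongr)⟩

/-- Near `xs`, perturbing the multiplier by `u` lowers the minimum of the Lagrangian by a multiple of
`‖u‖²` relative to its value at the old minimizer. -/
lemma exists_lagrangian_decrease (hP : StronglyConvexProgram f g α β)
    (hf : ContDiff ℝ 2 f) (hg : ∀ k, ContDiff ℝ 2 (g k)) {P : Fin m → Prop}
    (hsurj : ∀ b : Fin m → ℝ, ∃ d, ∀ k, P k → fderiv ℝ (g k) xs d = b k)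
    {R : ℝ} (hR : 0 ≤ R) :
    ∃ ρ c C : ℝ, 0 < ρ ∧ 0 < c ∧ 0 ≤ C ∧ ∀ x, ‖x - xs‖ < ρ →
      ∀ ν : EuclideanSpace ℝ (Fin m), ‖ν‖ ≤ R → IsMinOn (lagrangian f g ν) Set.univ x →
      ∀ u : EuclideanSpace ℝ (Fin m), (∀ k, ¬ P k → u k = 0) → ‖u‖ < ρ →
      ∃ d, ‖d‖ ≤ C * ‖u‖ ∧
        lagrangian f g (ν + u) (x + d) ≤ lagrangian f g (ν + u) x - c * ‖u‖ ^ 2 := by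
  obtain ⟨c₀, hc₀, hlow⟩ := exists_le_norm_gradientComb hsurj
  obtain ⟨M, r, hM, hr, hrem⟩ := exists_uniform_remainder_bound hf hg xs
  have hβ := hP.2.2.1
  -- `M'` bounds the second-order remainder of the Lagrangian, whose multipliers are at most `R + 1`
  -- in absolute value. The step `s = 1 / (2 * M')` maximizes the net decrease `s ‖w‖² - M' s²
  -- ‖w‖²`, which becomes `s / 2 * ‖w‖ ^ 2`.
  set M' : ℝ := M * (1 + m * (R + 1)) with hM'
  have hM'0 : 0 < M' := by positivity
  set s : ℝ := 1 / (2 * M') with hs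
  have hs0 : 0 < s := by positivity
  set C : ℝ := s * (m * β) with hC
  have hC0 : 0 ≤ C := by positivity
  -- The radius keeps `‖u‖ < 1`, keeps `x` and `x + d` in the ball of radius `r`, and lets the
  -- transposed Jacobian at `x` retain half of the injectivity constant `c₀`.
  refine ⟨min 1 (min (r / (1 + C)) (c₀ / (2 * (m * M + 1)))), s / 8 * c₀ ^ 2, C, by positivity,
    by positivity, hC0, fun x hx ν hν hmin u hu hun => ?_⟩
  obtain ⟨-, hx2⟩ := lt_min_iff.1 hx
  obtain ⟨hx2, hx3⟩ := lt_min_iff.1 hx2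
  obtain ⟨hu1, hu2⟩ := lt_min_iff.1 hun
  obtain ⟨hu2, -⟩ := lt_min_iff.1 hu2
  rw [lt_div_iff₀ (by positivity)] at hx2 hu2 hx3
  set w := gradientComb g x u with hw
  have hwle : ‖w‖ ≤ m * β * ‖u‖ := norm_sum_smul_le u fun k => norm_gradient_le hP k x
  have hxball : x ∈ Metric.ball xs r := by
    rw [mem_ball_iff_norm]
    nlinarith [norm_nonneg (x - xs)]
  have hxsball : xs ∈ Metric.ball xs r := Metric.mem_ball_self hr
  have hwge : c₀ / 2 * ‖u‖ ≤ ‖w‖ := by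
    have h1 : ‖gradientComb g xs u - w‖ ≤ m * (M * ‖x - xs‖) * ‖u‖ := by
      have : gradientComb g xs u - w = ∑ k, u k • (gradient (g k) xs - gradient (g k) x) := by
        simp [hw, gradientComb, smul_sub, Finset.sum_sub_distrib]
      rw [this]
      refine norm_sum_smul_le u fun k => ?_
      rw [norm_gradient_sub, norm_sub_rev x xs]
      exact ((hrem x hxball xs hxsball).2 k).2
    have h2 := hlow u hu
    have h3 := norm_le_insert' (gradientComb g xs u) w
    have h4 : m * (M * ‖x - xs‖) ≤ c₀ / 2 := by nlinarith [norm_nonneg (x - xs)]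
    have h5 : m * (M * ‖x - xs‖) * ‖u‖ ≤ c₀ / 2 * ‖u‖ := by gcongr
    linarith
  set d := -(s • w) with hd
  have hdn : ‖d‖ = s * ‖w‖ := by rw [hd, norm_neg, norm_smul, Real.norm_of_nonneg hs0.le]
  have hdle : ‖d‖ ≤ C * ‖u‖ := by
    rw [hdn, hC, mul_assoc]
    gcongr
  refine ⟨d, hdle, ?_⟩
  have hxdball : x + d ∈ Metric.ball xs r := by
    rw [mem_ball_iff_norm]
    have h1 : ‖x + d - xs‖ ≤ ‖x - xs‖ + ‖d‖ := by
      have : x + d - xs = (x - xs) + d := by abel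
      rw [this]; exact norm_add_le _ _
    by_cases h : ‖x - xs‖ ≤ ‖u‖
    · nlinarith
    · push Not at h
      nlinarith
  obtain ⟨hrf, hrg⟩ := hrem x hxball (x + d) hxdball
  rw [add_sub_cancel_left] at hrf
  have hrg' : ∀ k, |g k (x + d) - g k x - fderiv ℝ (g k) x d| ≤ M * ‖d‖ ^ 2 := fun k => by
    have := (hrg k).1
    rwa [add_sub_cancel_left] at this
  -- Stationarity at the old minimizer cancels the `ν` part of the first-order change; only `u`
  -- contributes, namely `-(s * ‖w‖ ^ 2)`.
  have hstat : fderiv ℝ f x d + ∑ k, ν k * fderiv ℝ (g k) x d = 0 := by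
    have hF := hasFDerivAt_lagrangian (hf.differentiable (by norm_num) x)
      (fun k => (hg k).differentiable (by norm_num) x) ν
    have h0 := (hmin.isLocalMin univ_mem).hasFDerivAt_eq_zero hF
    have := congrArg (fun T : EuclideanSpace ℝ (Fin n) →L[ℝ] ℝ => T d) h0
    simpa using this
  have hinner : ∑ k, u k * fderiv ℝ (g k) x d = -(s * ‖w‖ ^ 2) := by
    rw [← inner_gradientComb, ← hw, hd, inner_neg_right, inner_smul_right,
      real_inner_self_eq_norm_sq]
  have hsum : ∑ k, (ν k + u k) * (g k (x + d) - g k x - fderiv ℝ (g k) x d)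
      ≤ m * (R + 1) * (M * ‖d‖ ^ 2) := by
    calc ∑ k, (ν k + u k) * (g k (x + d) - g k x - fderiv ℝ (g k) x d)
        ≤ ∑ _k : Fin m, (R + 1) * (M * ‖d‖ ^ 2) := by
          refine Finset.sum_le_sum fun k _ => (le_abs_self _).trans ?_
          rw [abs_mul]
          gcongr
          · refine (abs_add_le _ _).trans (add_le_add ?_ ?_)
            · exact (PiLp.norm_apply_le ν k).trans hν
            · exact (PiLp.norm_apply_le u k).trans hu1.le
          · exact hrg' k
      _ = m * (R + 1) * (M * ‖d‖ ^ 2) := by simp; ring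
  have hsplit : ∑ k, (ν k + u k) * (g k (x + d) - g k x - fderiv ℝ (g k) x d)
      = ∑ k, (ν k + u k) * g k (x + d) - ∑ k, (ν k + u k) * g k x
        - (∑ k, ν k * fderiv ℝ (g k) x d + ∑ k, u k * fderiv ℝ (g k) x d) := by
    rw [← Finset.sum_sub_distrib, ← Finset.sum_add_distrib, ← Finset.sum_sub_distrib]
    exact Finset.sum_congr rfl fun k _ => by ring
  have hf' := (abs_le.1 hrf).2
  have hmain : lagrangian f g (ν + u) (x + d) - lagrangian f g (ν + u) x
      ≤ M' * ‖d‖ ^ 2 - s * ‖w‖ ^ 2 := by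
    simp only [lagrangian, PiLp.add_apply]
    have : M' * ‖d‖ ^ 2 = M * ‖d‖ ^ 2 + m * (R + 1) * (M * ‖d‖ ^ 2) := by rw [hM']; ring
    linarith
  have hval : M' * ‖d‖ ^ 2 - s * ‖w‖ ^ 2 = -(s / 2 * ‖w‖ ^ 2) := by
    rw [hdn, hs]; field_simp; ring
  have hsq : (c₀ / 2 * ‖u‖) ^ 2 ≤ ‖w‖ ^ 2 := by gcongr
  have : s / 2 * (c₀ / 2 * ‖u‖) ^ 2 ≤ s / 2 * ‖w‖ ^ 2 := by gcongr
  have e : s / 2 * (c₀ / 2 * ‖u‖) ^ 2 = s / 8 * c₀ ^ 2 * ‖u‖ ^ 2 := by ring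
  linarith

/-- The active part `u` of `l - ls` is handled by `exists_lagrangian_decrease` at `xs`. On inactive
constraints `ls` vanishes, and the slack gives a linear loss `δ * l k`, which dominates `δ * l k ^
2` because `l k ≤ 1`. -/
lemma locallyQuadraticDual (hP : StronglyConvexProgram f g α β) (hD : DualWellDefined f g)
    (hf : ContDiff ℝ 2 f) (hg : ∀ k, ContDiff ℝ 2 (g k)) (hxs : IsSolution f g xs)
    (hsurj : ∀ b : Fin m → ℝ, ∃ d, ∀ k, g k xs = 0 → fderiv ℝ (g k) xs d = b k) :
    LocallyQuadraticDual f g := by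
  classical
  intro ls hls
  obtain ⟨hq, hmin, hcs⟩ := hls.dual_eq_and_isMinOn hxs
  obtain ⟨ρ, c, C, hρ, hc, hC, hdec⟩ :=
    exists_lagrangian_decrease hP hf hg hsurj (norm_nonneg ls)
  have hβ := hP.2.2.1
  -- Slack `2 * δ` at `xs`, so that `δ` survives the move to `xs + d`.
  obtain ⟨δ, hδ, hδ0⟩ : ∃ δ : ℝ, (∀ k, g k xs ≠ 0 → g k xs ≤ -(2 * δ)) ∧ 0 < δ := by
    have hev : ∀ᶠ δ : ℝ in 𝓝[>] 0, ∀ k, g k xs ≠ 0 → g k xs ≤ -(2 * δ) := by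
      refine eventually_all.2 fun k => ?_
      by_cases hk : g k xs = 0
      · exact Eventually.of_forall fun _ h => absurd hk h
      · have : g k xs < 0 := lt_of_le_of_ne (hxs.1 k) hk
        filter_upwards [Ioo_mem_nhdsGT (show 0 < -(g k xs) / 2 by linarith)] with δ hδ _
        have := hδ.2
        linarith
    exact (hev.and self_mem_nhdsWithin).exists
  refine ⟨min 1 (min (ρ / 2) (δ / (β * C + 1))), min c δ, by positivity, by positivity,
    fun l hl hdist => ?_⟩
  obtain ⟨h1, h2⟩ := le_min_iff.1 hdist
  obtain ⟨h2, h3⟩ := le_min_iff.1 h2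
  rw [le_div_iff₀ (by positivity)] at h3
  let u : EuclideanSpace ℝ (Fin m) := WithLp.toLp 2 fun k => if g k xs = 0 then l k - ls k else 0
  have hu : ∀ k, u k = if g k xs = 0 then l k - ls k else 0 := fun _ => rfl
  have hun : ‖u‖ ≤ ‖l - ls‖ := by
    rw [EuclideanSpace.norm_eq, EuclideanSpace.norm_eq]
    refine Real.sqrt_le_sqrt (Finset.sum_le_sum fun k _ => ?_)
    rw [hu]
    split_ifs
    · rfl
    · rw [norm_zero, zero_pow two_ne_zero]; positivity
  obtain ⟨d, hd, hlag⟩ := hdec xs (by simpa using hρ) ls le_rfl hmin u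
    (fun k hk => by rw [hu, if_neg hk]) (by linarith)
  have hval : lagrangian f g (ls + u) xs = dual f g ls := by
    rw [hq, lagrangian, Finset.sum_eq_zero, add_zero]
    intro k _
    rw [PiLp.add_apply, add_mul, hcs k, hu]
    split_ifs with hk
    · rw [hk]; ring
    · ring
  have hins : ∀ k, g k xs ≠ 0 → g k (xs + d) ≤ -δ := by
    intro k hk
    have h4 := (abs_le.1 (hP.2.2.2 k xs (xs + d))).2
    rw [add_sub_cancel_left] at h4
    have h5 : β * ‖d‖ ≤ δ := by
      have : β * ‖d‖ ≤ β * (C * ‖l - ls‖) := by gcongr; exact hd.trans (by gcongr)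
      nlinarith [norm_nonneg (l - ls)]
    have := hδ k hk
    linarith
  have hle := dual_le_lagrangian hD hl (xs + d)
  rw [lagrangian_eq_add (ls + u) l, inner_eq_sum] at hle
  have hsum : ∑ k, (l - (ls + u)) k * constraintVec g (xs + d) k
      ≤ c * ‖u‖ ^ 2 - min c δ * ‖l - ls‖ ^ 2 := by
    rw [EuclideanSpace.real_norm_sq_eq, EuclideanSpace.real_norm_sq_eq, Finset.mul_sum,
      Finset.mul_sum, ← Finset.sum_sub_distrib]
    refine Finset.sum_le_sum fun k _ => ?_
    have hmc := min_le_left c δ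
    have hmδ := min_le_right c δ
    simp only [PiLp.sub_apply, PiLp.add_apply, constraintVec_apply, hu]
    split_ifs with hk
    · have : min c δ * (l k - ls k) ^ 2 ≤ c * (l k - ls k) ^ 2 := by gcongr
      have e : l k - (ls k + (l k - ls k)) = 0 := by ring
      rw [e]; linarith
    · have hls0 : ls k = 0 := (mul_eq_zero.1 (hcs k)).resolve_right hk
      have hlk : l k ≤ 1 := by
        have := (PiLp.norm_apply_le (l - ls) k).trans h1
        rw [PiLp.sub_apply, hls0, sub_zero] at this
        exact (le_abs_self _).trans this
      have hl0 := hl k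
      rw [hls0]
      have h6 : l k * g k (xs + d) ≤ l k * -δ := by gcongr; exact hins k hk
      have h7 : min c δ * (l k) ^ 2 ≤ δ * l k := by
        have : (l k) ^ 2 ≤ l k := by nlinarith
        calc min c δ * (l k) ^ 2 ≤ δ * (l k) ^ 2 := by gcongr
          _ ≤ δ * l k := by gcongr
      have e : (l k - (0 + 0)) * g k (xs + d) = l k * g k (xs + d) := by ring
      rw [e, sub_zero]
      linarith
  linarith

/-- With all gradients independent, the decrease applies in every direction at the minimizer of each
nearby multiplier, giving supergradient inequalities with a uniform quadratic gain. Taken at `a • l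
+ b • l'` and averaged, their linear terms cancel and `c * a * b * ‖l - l'‖ ^ 2` remains, whence the
modulus `2 * c`. -/
lemma locallyStronglyConcaveDual (hP : StronglyConvexProgram f g α β) (hD : DualWellDefined f g)
    (hgc : ∀ k, ConvexOn ℝ Set.univ (g k))
    (hf : ContDiff ℝ 2 f) (hg : ∀ k, ContDiff ℝ 2 (g k)) (hxs : IsSolution f g xs)
    (hsurj : ∀ b : Fin m → ℝ, ∃ d, ∀ k, fderiv ℝ (g k) xs d = b k) :
    LocallyStronglyConcaveDual f g := by
  intro ls hls
  obtain ⟨-, hmin, -⟩ := hls.dual_eq_and_isMinOn hxs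
  obtain ⟨ρ, c, C, hρ, hc, hC, hdec⟩ := exists_lagrangian_decrease (P := fun _ => True) hP hf hg
    (fun b => (hsurj b).imp fun d hd k _ => hd k) (R := ‖ls‖ + 1) (by positivity)
  have hα := hP.1
  have hβ := hP.2.2.1
  set κ : ℝ := √m * β / α with hκ
  have hκ0 : 0 ≤ κ := by positivity
  -- Makes `κ * D` (drift of the minimizer) and `2 * D` (distance between two multipliers) strictly
  -- smaller than `ρ`, and `‖ν‖ ≤ ‖ls‖ + 1`.
  set D : ℝ := min 1 (ρ / (3 + κ)) with hDdef
  have hD0 : 0 < D := by positivity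
  have hD1 : D ≤ 1 := min_le_left _ _
  have hDρ : D * (3 + κ) ≤ ρ := (le_div_iff₀ (by positivity)).1 (min_le_right _ _)
  have hconv : Convex ℝ {l | l ∈ orthant m ∧ ‖l - ls‖ ≤ D} := by
    have : {l | l ∈ orthant m ∧ ‖l - ls‖ ≤ D} = orthant m ∩ Metric.closedBall ls D := by
      ext l; simp [dist_eq_norm]
    rw [this]
    exact convex_orthant.inter (convex_closedBall _ _)
  have hsuper : ∀ ν ∈ orthant m, ‖ν - ls‖ ≤ D → ∃ z : EuclideanSpace ℝ (Fin m),
      ∀ l ∈ orthant m, ‖l - ls‖ ≤ D →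
        dual f g l ≤ dual f g ν + inner ℝ (l - ν) z - c * ‖l - ν‖ ^ 2 := by
    intro ν hν hνd
    obtain ⟨x, hxeq⟩ := (hD ν hν).1
    have hx : IsMinOn (lagrangian f g ν) Set.univ x := fun y _ => by
      show lagrangian f g ν x ≤ lagrangian f g ν y
      rw [hxeq]; exact dual_le_lagrangian hD hν y
    refine ⟨constraintVec g x, fun l hl hld => ?_⟩
    have hxn : ‖x - xs‖ < ρ := by
      have h1 := norm_argmin_sub_le hP hgc hls.1 hν hmin hx
      have h2 : κ * ‖ν - ls‖ ≤ κ * D := by gcongr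
      nlinarith
    have hνn : ‖ν‖ ≤ ‖ls‖ + 1 := by
      have := norm_le_insert' ν ls
      linarith
    have hln : ‖l - ν‖ < ρ := by
      have h1 : ‖l - ν‖ ≤ ‖l - ls‖ + ‖ν - ls‖ := by
        have := norm_sub_le (l - ls) (ν - ls)
        rwa [sub_sub_sub_cancel_right] at this
      nlinarith
    obtain ⟨d, -, hd⟩ := hdec x hxn ν hνn hx (l - ν) (fun k hk => absurd trivial hk) hln
    rw [add_sub_cancel] at hd
    have h1 := dual_le_lagrangian hD hl (x + d)
    rw [lagrangian_eq_add ν l x, hxeq] at hd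
    linarith
  refine ⟨D, 2 * c, hD0, by positivity, hconv, fun l hl l' hl' a b ha hb hab => ?_⟩
  obtain ⟨hν, hνd⟩ := hconv hl hl' ha hb hab
  obtain ⟨z, hz⟩ := hsuper _ hν hνd
  have hb' : b = 1 - a := by linarith
  have e1 : l - (a • l + b • l') = b • (l - l') := by subst hb'; module
  have e2 : l' - (a • l + b • l') = (-a) • (l - l') := by subst hb'; module
  have h1 := mul_le_mul_of_nonneg_left (hz l hl.1 hl.2) ha
  have h2 := mul_le_mul_of_nonneg_left (hz l' hl'.1 hl'.2) hb
  rw [e1, inner_smul_left, norm_smul] at h1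
  rw [e2, inner_smul_left, norm_smul] at h2
  simp only [conj_trivial, mul_pow, Real.norm_eq_abs, sq_abs, neg_sq, smul_eq_mul] at h1 h2 ⊢
  generalize dual f g (a • l + b • l') = q at *
  subst hb'
  nlinarith

end LocalCurvature

end DriftPlusPenalty

namespace DriftPlusPenalty

/-! ### The algorithm as projected dual ascent, and errors of the averages. -/

section Algorithm

variable {n m : ℕ} {f : EuclideanSpace ℝ (Fin n) → ℝ}
  {g : Fin m → EuclideanSpace ℝ (Fin n) → ℝ} {xs : EuclideanSpace ℝ (Fin n)} {α β V : ℝ}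
  {Q0 : EuclideanSpace ℝ (Fin m)} {x : ℕ → EuclideanSpace ℝ (Fin n)}
  {Q : ℕ → EuclideanSpace ℝ (Fin m)} {xbar : ℕ → EuclideanSpace ℝ (Fin n)}
  {ls : EuclideanSpace ℝ (Fin m)} {D L : ℝ}

lemma smul_mem_orthant {c : ℝ} (hc : 0 ≤ c) {l : EuclideanSpace ℝ (Fin m)} (hl : l ∈ orthant m) :
    c • l ∈ orthant m := fun k => by simpa using mul_nonneg hc (hl k)

lemma mul_lagrangian_inv_smul (hV : 0 < V) (q : EuclideanSpace ℝ (Fin m))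
    (y : EuclideanSpace ℝ (Fin n)) :
    V * lagrangian f g (V⁻¹ • q) y = V * f y + ∑ k, q k * g k y := by
  rw [lagrangian, mul_add, Finset.mul_sum]
  congr 1
  refine Finset.sum_congr rfl fun k _ => ?_
  rw [PiLp.smul_apply, smul_eq_mul]
  field_simp

lemma isMinOn_lagrangian_inv_smul_iff (hV : 0 < V) {q : EuclideanSpace ℝ (Fin m)}
    {y : EuclideanSpace ℝ (Fin n)} :
    IsMinOn (lagrangian f g (V⁻¹ • q)) Set.univ y ↔
      IsMinOn (fun y => V * f y + ∑ k, q k * g k y) Set.univ y := by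
  simp only [isMinOn_iff, ← mul_lagrangian_inv_smul hV, mul_le_mul_iff_right₀ hV]

lemma exists_isShiftedRun (hP : StronglyConvexProgram f g α β) (hfc : Continuous f)
    (hgc : ∀ k, ConvexOn ℝ Set.univ (g k)) (hV : 0 < V) (hQ0 : Q0 ∈ orthant m) :
    ∃ x Q xbar, IsShiftedRun f g V Q0 x Q xbar := by
  have hex : ∀ q : EuclideanSpace ℝ (Fin m), ∃ y, q ∈ orthant m →
      IsMinOn (fun y => V * f y + ∑ k, q k * g k y) Set.univ y := fun q => by
    by_cases hq : q ∈ orthant m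
    · obtain ⟨y, hy⟩ := exists_isMinOn_lagrangian hP hfc hgc
        (smul_mem_orthant (inv_nonneg.2 hV.le) hq)
      exact ⟨y, fun _ => (isMinOn_lagrangian_inv_smul_iff hV).1 hy⟩
    · exact ⟨0, fun h => absurd h hq⟩
  choose X hX using hex
  let Q : ℕ → EuclideanSpace ℝ (Fin m) := fun t =>
    Nat.rec Q0 (fun _ q => WithLp.toLp 2 fun k => max (q k + g k (X q)) 0) t
  have hQ : ∀ t, Q t ∈ orthant m := by
    intro t
    cases t with
    | zero => exact hQ0
    | succ t => exact fun k => le_max_right _ _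
  refine ⟨fun t => X (Q t), Q,
    -- Integer division serves both parities: an odd `t` repeats the window of `t - 1`. At `t = 0,
    -- 1` the sum is empty and the value is `0`.
    fun t => ((t / 2 : ℕ) : ℝ)⁻¹ • ∑ τ ∈ Finset.Ico (t / 2) (2 * (t / 2)), X (Q τ),
    rfl, fun t => hX _ (hQ t), fun t k => rfl, fun t ht => ?_, fun t ht => ?_⟩
  · obtain ⟨s, hs⟩ := ht
    have h1 : (t + 1) / 2 = s := by omega
    have h2 : ((t + 1 : ℕ) : ℝ) / 2 = s := by rw [hs]; push_cast; ring
    rw [h1, h2, show 2 * s = t + 1 by omega]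
  · obtain ⟨s, hs⟩ := ht
    have h1 : (t + 1) / 2 = t / 2 := by omega
    rw [h1]

lemma IsShiftedRun.queue_mem_orthant (hrun : IsShiftedRun f g V Q0 x Q xbar)
    (hQ0 : Q0 ∈ orthant m) (t : ℕ) : Q t ∈ orthant m := by
  cases t with
  | zero => rw [hrun.init]; exact hQ0
  | succ t => exact fun k => by rw [hrun.queue]; exact le_max_right _ _

lemma IsShiftedRun.scaled_mem_orthant (hrun : IsShiftedRun f g V Q0 x Q xbar) (hV : 0 < V)
    (hQ0 : Q0 ∈ orthant m) (t : ℕ) : V⁻¹ • Q t ∈ orthant m :=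
  smul_mem_orthant (inv_nonneg.2 hV.le) (hrun.queue_mem_orthant hQ0 t)

lemma IsShiftedRun.isMinOn (hrun : IsShiftedRun f g V Q0 x Q xbar) (hV : 0 < V) (t : ℕ) :
    IsMinOn (lagrangian f g (V⁻¹ • Q t)) Set.univ (x t) :=
  (isMinOn_lagrangian_inv_smul_iff hV).2 (hrun.argmin t)

/-- The first nonempty window ends at `t = 2`; the recursion leaves `xbar 0` free and copies it to
`xbar 1`. -/
lemma IsShiftedRun.xbar_eq (hrun : IsShiftedRun f g V Q0 x Q xbar) {t : ℕ} (ht : 2 ≤ t) :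
    xbar t = ((t / 2 : ℕ) : ℝ)⁻¹ • ∑ τ ∈ Finset.Ico (t / 2) (2 * (t / 2)), x τ := by
  have heven : ∀ s : ℕ, 1 ≤ s →
      xbar (2 * s) = (s : ℝ)⁻¹ • ∑ τ ∈ Finset.Ico s (2 * s), x τ := by
    intro s hs
    obtain ⟨j, hj⟩ : ∃ j, 2 * s = j + 1 := ⟨2 * s - 1, by omega⟩
    rw [hj, hrun.avg_even j (by rw [← hj]; exact even_two_mul s), ← hj]
    have h1 : 2 * s / 2 = s := by omega
    have h2 : ((2 * s : ℕ) : ℝ) / 2 = s := by push_cast; ring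
    rw [h1, h2]
  rcases Nat.even_or_odd' t with ⟨s, rfl | rfl⟩
  · rw [heven s (by omega), show 2 * s / 2 = s by omega]
  · rw [hrun.avg_odd (2 * s) (odd_two_mul_add_one s), heven s (by omega),
      show (2 * s + 1) / 2 = s by omega]

/-- The projected gradient step made by the scaled queues satisfies the three-point inequality. -/
lemma IsShiftedRun.three_point (hP : StronglyConvexProgram f g α β)
    (hgc : ∀ k, ConvexOn ℝ Set.univ (g k)) (hD : DualWellDefined f g) (hV : 0 < V)
    (hVβ : m * β ^ 2 / α ≤ V) (hQ0 : Q0 ∈ orthant m)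
    (hrun : IsShiftedRun f g V Q0 x Q xbar) (t : ℕ) {z : EuclideanSpace ℝ (Fin m)}
    (hz : z ∈ orthant m) :
    dual f g (V⁻¹ • Q t) + inner ℝ (z - V⁻¹ • Q t) (constraintVec g (x t))
      - V / 2 * ‖V⁻¹ • Q t - z‖ ^ 2 + V / 2 * ‖V⁻¹ • Q (t + 1) - z‖ ^ 2
      ≤ dual f g (V⁻¹ • Q (t + 1)) := by
  have h1 := dual_ge hP hgc hD hVβ (hrun.scaled_mem_orthant hV hQ0 t)
    (hrun.scaled_mem_orthant hV hQ0 (t + 1)) (hrun.isMinOn hV t)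
  -- The variational inequality of the projection onto the orthant, by coordinates: without
  -- truncation the second factor vanishes; with truncation the new queue is `0` and the second
  -- factor is nonpositive.
  have hproj : inner ℝ (z - V⁻¹ • Q (t + 1))
      (constraintVec g (x t) - V • (V⁻¹ • Q (t + 1) - V⁻¹ • Q t)) ≤ 0 := by
    rw [inner_eq_sum]
    refine Finset.sum_nonpos fun k _ => ?_
    have hzk := hz k
    have hq := hrun.queue t k
    simp only [PiLp.sub_apply, PiLp.smul_apply, smul_eq_mul, constraintVec_apply]
    have e : g k (x t) - V * (V⁻¹ * Q (t + 1) k - V⁻¹ * Q t k)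
        = g k (x t) + Q t k - Q (t + 1) k := by field_simp; ring
    rw [e]
    rcases le_total 0 (Q t k + g k (x t)) with h | h
    · rw [max_eq_left h] at hq
      rw [hq]
      have : g k (x t) + Q t k - (Q t k + g k (x t)) = 0 := by ring
      rw [this, mul_zero]
    · rw [max_eq_right h] at hq
      rw [hq]
      exact mul_nonpos_of_nonneg_of_nonpos (by simpa using hzk) (by linarith)
  generalize V⁻¹ • Q (t + 1) = l' at *
  generalize V⁻¹ • Q t = l at *
  have h2 : ‖l - z‖ ^ 2 = ‖l' - z‖ ^ 2 + 2 * inner ℝ (z - l') (l' - l) + ‖l' - l‖ ^ 2 := by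
    have : l - z = -((l' - l) + (z - l')) := by abel
    rw [this, norm_neg, norm_add_sq_real, norm_sub_rev l' z, real_inner_comm]
    ring
  rw [inner_sub_right, inner_smul_right] at hproj
  have h3 : inner ℝ (z - l) (constraintVec g (x t))
      = inner ℝ (z - l') (constraintVec g (x t)) + inner ℝ (l' - l) (constraintVec g (x t)) := by
    rw [← inner_add_left, sub_add_sub_cancel]
  rw [h2, h3]
  linarith

lemma dual_le_of_isSolution (hxs : IsSolution f g xs) (hD : DualWellDefined f g)
    {l : EuclideanSpace ℝ (Fin m)} (hl : l ∈ orthant m) : dual f g l ≤ f xs := by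
  have h1 := dual_le_lagrangian hD hl xs
  have h2 : ∑ k, l k * g k xs ≤ 0 := Finset.sum_nonpos fun k _ =>
    mul_nonpos_of_nonneg_of_nonpos (hl k) (hxs.1 k)
  rw [lagrangian] at h1
  linarith

lemma IsLagrangeMultiplier.dual_le (hls : IsLagrangeMultiplier f g ls) (hxs : IsSolution f g xs)
    (hD : DualWellDefined f g) {l : EuclideanSpace ℝ (Fin m)} (hl : l ∈ orthant m) :
    dual f g l ≤ dual f g ls := by
  rw [(hls.dual_eq_and_isMinOn hxs).1]
  exact dual_le_of_isSolution hxs hD hl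

/-- The three-point inequality at `z = ls`, with the supergradient inequality bounding its linear
part. -/
lemma IsShiftedRun.dual_gap_succ_le (hP : StronglyConvexProgram f g α β)
    (hgc : ∀ k, ConvexOn ℝ Set.univ (g k)) (hD : DualWellDefined f g) (hV : 0 < V)
    (hVβ : m * β ^ 2 / α ≤ V) (hQ0 : Q0 ∈ orthant m)
    (hrun : IsShiftedRun f g V Q0 x Q xbar) (hls : IsLagrangeMultiplier f g ls) (t : ℕ) :
    dual f g ls - dual f g (V⁻¹ • Q (t + 1))
      ≤ V / 2 * (‖V⁻¹ • Q t - ls‖ ^ 2 - ‖V⁻¹ • Q (t + 1) - ls‖ ^ 2) := by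
  have h1 := hrun.three_point hP hgc hD hV hVβ hQ0 t hls.1
  have h2 := dual_le_add_inner hD hls.1 (hrun.isMinOn hV t)
  linarith

lemma IsShiftedRun.dual_monotone (hP : StronglyConvexProgram f g α β)
    (hgc : ∀ k, ConvexOn ℝ Set.univ (g k)) (hD : DualWellDefined f g) (hV : 0 < V)
    (hVβ : m * β ^ 2 / α ≤ V) (hQ0 : Q0 ∈ orthant m)
    (hrun : IsShiftedRun f g V Q0 x Q xbar) (t : ℕ) :
    dual f g (V⁻¹ • Q t) ≤ dual f g (V⁻¹ • Q (t + 1)) := by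
  have h1 := hrun.three_point hP hgc hD hV hVβ hQ0 t (hrun.scaled_mem_orthant hV hQ0 t)
  simp only [sub_self, inner_zero_left, norm_zero] at h1
  have : 0 ≤ V / 2 * ‖V⁻¹ • Q (t + 1) - V⁻¹ • Q t‖ ^ 2 := by positivity
  linarith

/-- One-step gaps telescope, and by monotonicity the last gap is the smallest. The final distance is
kept because it also shows that the distance never exceeds its initial value. -/
lemma IsShiftedRun.mul_dual_gap_le (hP : StronglyConvexProgram f g α β)
    (hgc : ∀ k, ConvexOn ℝ Set.univ (g k)) (hD : DualWellDefined f g) (hV : 0 < V)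
    (hVβ : m * β ^ 2 / α ≤ V) (hQ0 : Q0 ∈ orthant m)
    (hrun : IsShiftedRun f g V Q0 x Q xbar) (hls : IsLagrangeMultiplier f g ls) (t : ℕ) :
    t * (dual f g ls - dual f g (V⁻¹ • Q t))
      ≤ V / 2 * (‖V⁻¹ • Q0 - ls‖ ^ 2 - ‖V⁻¹ • Q t - ls‖ ^ 2) := by
  induction t with
  | zero => simp [hrun.init]
  | succ t ih =>
    have h1 := hrun.dual_gap_succ_le hP hgc hD hV hVβ hQ0 hls t
    have h2 := hrun.dual_monotone hP hgc hD hV hVβ hQ0 t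
    have h3 := mul_le_mul_of_nonneg_left h2 (Nat.cast_nonneg (α := ℝ) t)
    push_cast
    linarith

lemma IsShiftedRun.norm_sub_le (hP : StronglyConvexProgram f g α β)
    (hgc : ∀ k, ConvexOn ℝ Set.univ (g k)) (hD : DualWellDefined f g) (hV : 0 < V)
    (hVβ : m * β ^ 2 / α ≤ V) (hQ0 : Q0 ∈ orthant m) (hxs : IsSolution f g xs)
    (hrun : IsShiftedRun f g V Q0 x Q xbar) (hls : IsLagrangeMultiplier f g ls) (t : ℕ) :
    ‖V⁻¹ • Q t - ls‖ ≤ ‖V⁻¹ • Q0 - ls‖ := by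
  have h1 := hrun.mul_dual_gap_le hP hgc hD hV hVβ hQ0 hls t
  have h2 : 0 ≤ t * (dual f g ls - dual f g (V⁻¹ • Q t)) := mul_nonneg (Nat.cast_nonneg t)
    (sub_nonneg.2 (hls.dual_le hxs hD (hrun.scaled_mem_orthant hV hQ0 t)))
  have h3 : 0 ≤ ‖V⁻¹ • Q0 - ls‖ ^ 2 - ‖V⁻¹ • Q t - ls‖ ^ 2 :=
    nonneg_of_mul_nonneg_right (h2.trans h1) (by positivity)
  exact le_of_sq_le_sq (sub_nonneg.1 h3) (norm_nonneg _)

/-- Points of the orthant with a small dual gap lie in the region of quadratic decay. -/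
lemma IsLocallyQuadraticAt.norm_sub_le_of_gap_lt (hq : IsLocallyQuadraticAt f g ls D L)
    (hls : IsLagrangeMultiplier f g ls) (hxs : IsSolution f g xs) (hD : DualWellDefined f g)
    {l : EuclideanSpace ℝ (Fin m)} (hl : l ∈ orthant m)
    (hgap : dual f g ls - dual f g l < L * D ^ 2) : ‖l - ls‖ ≤ D := by
  obtain ⟨hD0, -, hquad⟩ := hq
  by_contra! hlt
  have hpos : 0 < ‖l - ls‖ := hD0.trans hlt
  -- Pull `l` radially onto the sphere of radius `D`: by concavity the gap there is at most `s`
  -- times the gap at `l`, yet it is at least `L * D ^ 2`.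
  set s := D / ‖l - ls‖ with hs
  have hs0 : 0 ≤ s := by positivity
  have hs1 : s ≤ 1 := (div_le_one hpos).2 hlt.le
  have hmem := convex_orthant hls.1 hl (sub_nonneg.2 hs1) hs0 (by ring)
  have hconc := (concaveOn_dual hD).2 hls.1 hl (sub_nonneg.2 hs1) hs0 (by ring)
  have hn : ‖(1 - s) • ls + s • l - ls‖ = D := by
    have : (1 - s) • ls + s • l - ls = s • (l - ls) := by module
    rw [this, norm_smul, Real.norm_of_nonneg hs0, hs, div_mul_cancel₀ _ hpos.ne']
  have h1 := hquad _ hmem hn.le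
  rw [hn] at h1
  simp only [smul_eq_mul] at hconc
  have hle := hls.dual_le hxs hD hl
  nlinarith

lemma IsLocallyStronglyConcaveAt.isLocallyQuadraticAt
    (hc : IsLocallyStronglyConcaveAt f g ls D L) (hls : IsLagrangeMultiplier f g ls)
    (hxs : IsSolution f g xs) (hD : DualWellDefined f g) :
    IsLocallyQuadraticAt f g ls D (L / 2) := by
  obtain ⟨hD0, hL, hconc⟩ := hc
  refine ⟨hD0, by positivity, fun l hl hld => ?_⟩
  have hneg : StrongConvexOn {l | l ∈ orthant m ∧ ‖l - ls‖ ≤ D} L (-dual f g) := hconc.neg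
  have := StrongConvexOn.growth hneg ⟨hls.1, by simpa using hD0.le⟩ ⟨hl, hld⟩
    (fun y hy => neg_le_neg (hls.dual_le hxs hD hy.1))
  simp only [Pi.neg_apply] at this
  linarith

/-- Supergradient inequality of the dual under local strong concavity. -/
lemma IsLocallyStronglyConcaveAt.dual_add_le (hc : IsLocallyStronglyConcaveAt f g ls D L)
    (hls : IsLagrangeMultiplier f g ls) (hD : DualWellDefined f g)
    {l : EuclideanSpace ℝ (Fin m)} (hl : l ∈ orthant m) (hld : ‖l - ls‖ ≤ D)
    {y : EuclideanSpace ℝ (Fin n)} (hy : IsMinOn (lagrangian f g l) Set.univ y) :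
    dual f g ls + L / 2 * ‖l - ls‖ ^ 2
      ≤ dual f g l + inner ℝ (ls - l) (constraintVec g y) := by
  obtain ⟨hD0, hL, hconc⟩ := hc
  refine add_le_of_forall_one_sub_mul fun s hs0 hs1 => ?_
  have h1 := hconc.2 (x := l) ⟨hl, hld⟩ (y := ls) ⟨hls.1, by simpa using hD0.le⟩
    (sub_nonneg.2 hs1.le) hs0.le (by ring)
  have h2 := dual_le_add_inner hD
    (convex_orthant hl hls.1 (sub_nonneg.2 hs1.le) hs0.le (by ring)) hy
  have e : (1 - s) • l + s • ls - l = s • (ls - l) := by module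
  rw [e, inner_smul_left] at h2
  simp only [smul_eq_mul, conj_trivial] at h1 h2
  have h3 : s * (dual f g ls + (1 - s) * (L / 2 * ‖l - ls‖ ^ 2))
      ≤ s * (dual f g l + inner ℝ (ls - l) (constraintVec g y)) := by linarith
  exact le_of_mul_le_mul_left h3 hs0

/-- Strong concavity improves the supergradient inequality at `ls` by `L / 2 * ‖l - ls‖ ^ 2`; in the
three-point inequality this gain becomes a contraction. -/
lemma IsShiftedRun.norm_sq_succ_le (hP : StronglyConvexProgram f g α β)
    (hgc : ∀ k, ConvexOn ℝ Set.univ (g k)) (hD : DualWellDefined f g) (hV : 0 < V)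
    (hVβ : m * β ^ 2 / α ≤ V) (hQ0 : Q0 ∈ orthant m) (hxs : IsSolution f g xs)
    (hrun : IsShiftedRun f g V Q0 x Q xbar) (hls : IsLagrangeMultiplier f g ls)
    (hc : IsLocallyStronglyConcaveAt f g ls D L) {t : ℕ} (ht : ‖V⁻¹ • Q t - ls‖ ≤ D) :
    ‖V⁻¹ • Q (t + 1) - ls‖ ^ 2 ≤ (1 - L / V) * ‖V⁻¹ • Q t - ls‖ ^ 2 := by
  have h1 := hrun.three_point hP hgc hD hV hVβ hQ0 t hls.1
  have h2 := hc.dual_add_le hls hD (hrun.scaled_mem_orthant hV hQ0 t) ht (hrun.isMinOn hV t)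
  have h3 := hls.dual_le hxs hD (hrun.scaled_mem_orthant hV hQ0 (t + 1))
  have h4 : V / 2 * ‖V⁻¹ • Q (t + 1) - ls‖ ^ 2
      ≤ V / 2 * ((1 - L / V) * ‖V⁻¹ • Q t - ls‖ ^ 2) := by
    have : V / 2 * ((1 - L / V) * ‖V⁻¹ • Q t - ls‖ ^ 2)
        = V / 2 * ‖V⁻¹ • Q t - ls‖ ^ 2 - L / 2 * ‖V⁻¹ • Q t - ls‖ ^ 2 := by field_simp
    linarith
  exact le_of_mul_le_mul_left h4 (by positivity)

/-- The `O(1/t)` gap eventually drops below `L * D ^ 2`. The entry time depends on the run only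
through `V` and `Q0`, as the uniformity in `ErrorDecaysLike` requires. -/
lemma IsLocallyQuadraticAt.exists_forall_norm_sub_le (hP : StronglyConvexProgram f g α β)
    (hgc : ∀ k, ConvexOn ℝ Set.univ (g k)) (hD : DualWellDefined f g) (hV : 0 < V)
    (hVβ : m * β ^ 2 / α ≤ V) (hQ0 : Q0 ∈ orthant m) (hxs : IsSolution f g xs)
    (hls : IsLagrangeMultiplier f g ls) (hq : IsLocallyQuadraticAt f g ls D L) :
    ∃ T : ℕ, ∀ x Q xbar, IsShiftedRun f g V Q0 x Q xbar → ∀ t, T ≤ t →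
      ‖V⁻¹ • Q t - ls‖ ≤ D := by
  have hq' := hq
  obtain ⟨hD0, hL, -⟩ := hq'
  obtain ⟨T, hT⟩ := exists_nat_gt (V / 2 * ‖V⁻¹ • Q0 - ls‖ ^ 2 / (L * D ^ 2))
  rw [div_lt_iff₀ (by positivity)] at hT
  refine ⟨T, fun x Q xbar hrun t ht => ?_⟩
  refine hq.norm_sub_le_of_gap_lt hls hxs hD (hrun.scaled_mem_orthant hV hQ0 t) ?_
  by_contra! hge
  have h1 := hrun.mul_dual_gap_le hP hgc hD hV hVβ hQ0 hls t
  have h2 : (T : ℝ) * (L * D ^ 2) ≤ t * (dual f g ls - dual f g (V⁻¹ • Q t)) := by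
    gcongr
  have h3 : 0 ≤ V / 2 * ‖V⁻¹ • Q t - ls‖ ^ 2 := by positivity
  linarith

/-- The drift-plus-penalty inequality. -/
lemma IsShiftedRun.drift_le (hP : StronglyConvexProgram f g α β)
    (hgc : ∀ k, ConvexOn ℝ Set.univ (g k)) (hV : 0 < V)
    (hVβ : m * β ^ 2 / α ≤ V) (hQ0 : Q0 ∈ orthant m) (hxs : IsSolution f g xs)
    (hrun : IsShiftedRun f g V Q0 x Q xbar) (t : ℕ) :
    V * f (x t) + ‖Q (t + 1)‖ ^ 2 / 2 - ‖Q t‖ ^ 2 / 2 ≤ V * f xs := by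
  have hα := hP.1
  have h1 := StrongConvexOn.growth (lagrangian_strongConvexOn hP.2.1 hgc
    (hrun.scaled_mem_orthant hV hQ0 t)) (Set.mem_univ (x t)) (Set.mem_univ xs) (hrun.isMinOn hV t)
  have h2 := mul_le_mul_of_nonneg_left h1 hV.le
  rw [mul_add, mul_lagrangian_inv_smul hV, mul_lagrangian_inv_smul hV] at h2
  -- The growth term of the minimized objective pays for the second-order drift term, because `m * β
  -- ^ 2 ≤ α * V`.
  have h3 : ‖constraintVec g xs - constraintVec g (x t)‖ ^ 2 ≤ α * V * ‖xs - x t‖ ^ 2 := by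
    have h := norm_constraintVec_sub_le hP (x t) xs
    calc ‖constraintVec g xs - constraintVec g (x t)‖ ^ 2
        ≤ (√m * β * ‖xs - x t‖) ^ 2 := by gcongr
      _ = m * β ^ 2 * ‖xs - x t‖ ^ 2 := by
          rw [mul_pow, mul_pow, Real.sq_sqrt (Nat.cast_nonneg m)]
      _ ≤ α * V * ‖xs - x t‖ ^ 2 := by
          refine mul_le_mul_of_nonneg_right ?_ (sq_nonneg _)
          rw [div_le_iff₀ hα] at hVβ
          linarith
  -- Feasibility `g k xs ≤ 0` allows the usual drift term `g k (x t) ^ 2 / 2` to be replaced by the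
  -- squared difference from `g k xs`.
  have h4 : ‖Q (t + 1)‖ ^ 2 / 2 - ‖Q t‖ ^ 2 / 2 ≤ ∑ k, Q t k * g k (x t) - ∑ k, Q t k * g k xs
      + ‖constraintVec g xs - constraintVec g (x t)‖ ^ 2 / 2 := by
    simp only [EuclideanSpace.real_norm_sq_eq, Finset.sum_div]
    rw [← Finset.sum_sub_distrib, ← Finset.sum_sub_distrib, ← Finset.sum_add_distrib]
    refine Finset.sum_le_sum fun k _ => ?_
    rw [hrun.queue t k]
    simp only [PiLp.sub_apply, constraintVec_apply]
    have hs := hxs.1 k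
    rcases le_total 0 (Q t k + g k (x t)) with h | h
    · rw [max_eq_left h]
      nlinarith [mul_nonneg h (neg_nonneg.2 hs), sq_nonneg (g k xs)]
    · rw [max_eq_right h]
      nlinarith [sq_nonneg (Q t k + g k (x t) - g k xs)]
  linarith

lemma sum_Ico_le_of_add_le {a b : ℕ → ℝ} (h : ∀ t, a t ≤ b t - b (t + 1)) {s t : ℕ}
    (hst : s ≤ t) : ∑ τ ∈ Finset.Ico s t, a τ ≤ b s - b t := by
  induction t, hst using Nat.le_induction with
  | base => simp
  | succ t hst ih =>
    rw [Finset.sum_Ico_succ_top hst]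
    linarith [h t]

lemma ConvexOn.map_average_le {E : Type*} [AddCommGroup E] [Module ℝ E] {h : E → ℝ}
    (hh : ConvexOn ℝ Set.univ h) {s : ℕ} (hs : 1 ≤ s) (y : ℕ → E) :
    h ((s : ℝ)⁻¹ • ∑ τ ∈ Finset.Ico s (2 * s), y τ)
      ≤ (s : ℝ)⁻¹ * ∑ τ ∈ Finset.Ico s (2 * s), h (y τ) := by
  have hs0 : (s : ℝ) ≠ 0 := by positivity
  rw [Finset.smul_sum, Finset.mul_sum]
  refine hh.map_sum_le (fun _ _ => by positivity) ?_ (fun _ _ => Set.mem_univ _)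
  rw [Finset.sum_const, Nat.card_Ico, nsmul_eq_mul, show 2 * s - s = s by omega]
  exact mul_inv_cancel₀ hs0

/-- The errors of the shifted average are controlled by the distance of the scaled queues from a
multiplier, divided by the window length. -/
lemma IsShiftedRun.error_le (hP : StronglyConvexProgram f g α β)
    (hgc : ∀ k, ConvexOn ℝ Set.univ (g k)) (hV : 0 < V)
    (hVβ : m * β ^ 2 / α ≤ V) (hQ0 : Q0 ∈ orthant m) (hxs : IsSolution f g xs)
    (hrun : IsShiftedRun f g V Q0 x Q xbar) {t : ℕ} (ht : 2 ≤ t) {ρ R : ℝ} (hρR : ρ ≤ R)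
    (h₁ : ‖V⁻¹ • Q (t / 2) - ls‖ ≤ ρ) (h₂ : ‖V⁻¹ • Q (2 * (t / 2)) - ls‖ ≤ ρ) :
    f (xbar t) ≤ f xs + 2 * V * (‖ls‖ + R + 1) * ρ / (t / 2 : ℕ) ∧
      ∀ k, g k (xbar t) ≤ 2 * V * (‖ls‖ + R + 1) * ρ / (t / 2 : ℕ) := by
  rw [hrun.xbar_eq ht]
  set s := t / 2 with hs
  have hs1 : 1 ≤ s := by omega
  have hs0 : (0 : ℝ) < s := by positivity
  have hρ0 : 0 ≤ ρ := (norm_nonneg _).trans h₁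
  have hQ : ∀ τ, Q τ = V • (V⁻¹ • Q τ) := fun τ => by
    rw [smul_smul, mul_inv_cancel₀ hV.ne', one_smul]
  have hdiff : ‖Q (2 * s) - Q s‖ ≤ V * (2 * ρ) := by
    rw [hQ (2 * s), hQ s, ← smul_sub, norm_smul, Real.norm_of_nonneg hV.le]
    gcongr
    have := _root_.norm_sub_le (V⁻¹ • Q (2 * s) - ls) (V⁻¹ • Q s - ls)
    rw [sub_sub_sub_cancel_right] at this
    linarith
  have hnorm : ∀ τ, ‖V⁻¹ • Q τ - ls‖ ≤ ρ → ‖Q τ‖ ≤ V * (‖ls‖ + R) := fun τ hτ => by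
    rw [hQ τ, norm_smul, Real.norm_of_nonneg hV.le]
    gcongr
    have := norm_le_insert' (V⁻¹ • Q τ) ls
    linarith
  have hdiv : ∀ a b : ℝ, a ≤ b → (s : ℝ)⁻¹ * a ≤ b / s := fun a b hab => by
    rw [inv_mul_eq_div]; gcongr
  constructor
  · have hconv : ConvexOn ℝ Set.univ f := strongConvexOn_zero.1 (hP.2.1.mono hP.1.le)
    -- The drift telescopes; factoring the difference of squares gives one factor of order `ρ` and
    -- one bounded through `R`.
    have h3 : ∑ τ ∈ Finset.Ico s (2 * s), (f (x τ) - f xs)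
        ≤ ‖Q s‖ ^ 2 / (2 * V) - ‖Q (2 * s)‖ ^ 2 / (2 * V) := by
      refine sum_Ico_le_of_add_le (b := fun τ => ‖Q τ‖ ^ 2 / (2 * V)) (fun τ => ?_) (by omega)
      have := hrun.drift_le hP hgc hV hVβ hQ0 hxs τ
      rw [← sub_div, le_div_iff₀ (by positivity)]
      linarith
    have h4 : ‖Q s‖ ^ 2 / (2 * V) - ‖Q (2 * s)‖ ^ 2 / (2 * V)
        ≤ 2 * V * (‖ls‖ + R + 1) * ρ := by
      rw [← sub_div, div_le_iff₀ (by positivity)]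
      have h5 : ‖Q s‖ - ‖Q (2 * s)‖ ≤ V * (2 * ρ) := by
        have := norm_sub_norm_le (Q s) (Q (2 * s))
        rw [norm_sub_rev] at this
        linarith
      have h6 := hnorm s h₁
      have h7 := hnorm (2 * s) h₂
      calc ‖Q s‖ ^ 2 - ‖Q (2 * s)‖ ^ 2
          = (‖Q s‖ - ‖Q (2 * s)‖) * (‖Q s‖ + ‖Q (2 * s)‖) := by ring
        _ ≤ (V * (2 * ρ)) * (‖Q s‖ + ‖Q (2 * s)‖) := by gcongr
        _ ≤ (V * (2 * ρ)) * (V * (‖ls‖ + R) + V * (‖ls‖ + R)) := by gcongr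
        -- The `+ 1` makes the same constant cover the constraint bound `2 * V * ρ`.
        _ ≤ (V * (2 * ρ)) * (V * (‖ls‖ + R + 1) + V * (‖ls‖ + R + 1)) := by
            have : V * (‖ls‖ + R) ≤ V * (‖ls‖ + R + 1) :=
              mul_le_mul_of_nonneg_left (by linarith) hV.le
            exact mul_le_mul_of_nonneg_left (by linarith) (by positivity)
        _ = 2 * V * (‖ls‖ + R + 1) * ρ * (2 * V) := by ring
    have h5 := hdiv _ _ (h3.trans h4)
    have h6 := ConvexOn.map_average_le hconv hs1 x
    rw [Finset.sum_sub_distrib, Finset.sum_const, Nat.card_Ico, nsmul_eq_mul,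
      show 2 * s - s = s by omega, mul_sub, inv_mul_cancel_left₀ hs0.ne'] at h5
    linarith
  · intro k
    have h3 : ∑ τ ∈ Finset.Ico s (2 * s), g k (x τ) ≤ -Q s k - -Q (2 * s) k := by
      refine sum_Ico_le_of_add_le (b := fun τ => -Q τ k) (fun τ => ?_) (by omega)
      have := hrun.queue τ k
      have := le_max_left (Q τ k + g k (x τ)) 0
      linarith
    have h4 : -Q s k - -Q (2 * s) k ≤ 2 * V * (‖ls‖ + R + 1) * ρ := by
      have h5 : Q (2 * s) k - Q s k ≤ V * (2 * ρ) :=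
        (le_abs_self _).trans ((PiLp.norm_apply_le (Q (2 * s) - Q s) k).trans hdiff)
      have h6 : 0 ≤ (‖ls‖ + R) * (V * (2 * ρ)) := by
        have : 0 ≤ R := hρ0.trans hρR
        positivity
      nlinarith
    exact (ConvexOn.map_average_le (hgc k) hs1 x).trans (hdiv _ _ (h3.trans h4))

end Algorithm

end DriftPlusPenalty

namespace DriftPlusPenalty

/-! ### Decay rates and convergence times. -/

section Rates

variable {n m : ℕ} {f : EuclideanSpace ℝ (Fin n) → ℝ}
  {g : Fin m → EuclideanSpace ℝ (Fin n) → ℝ} {xs : EuclideanSpace ℝ (Fin n)} {α β V : ℝ}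
  {Q0 : EuclideanSpace ℝ (Fin m)} {ls : EuclideanSpace ℝ (Fin m)} {D L : ℝ}

lemma div_three_le_half {t : ℕ} (ht : 2 ≤ t) : (t : ℝ) / 3 ≤ (t / 2 : ℕ) := by
  have h : t ≤ 3 * (t / 2) := by omega
  have h' : (t : ℝ) ≤ 3 * (t / 2 : ℕ) := by exact_mod_cast h
  linarith

lemma errorDecaysLike_of_isLocallyQuadraticAt (hP : StronglyConvexProgram f g α β)
    (hgc : ∀ k, ConvexOn ℝ Set.univ (g k)) (hD : DualWellDefined f g) (hV : 0 < V)
    (hVβ : m * β ^ 2 / α ≤ V) (hQ0 : Q0 ∈ orthant m) (hxs : IsSolution f g xs)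
    (hls : IsLagrangeMultiplier f g ls) (hq : IsLocallyQuadraticAt f g ls D L) :
    ErrorDecaysLike f g xs V Q0 (fun t => 1 / (t : ℝ) ^ (3 / 2 : ℝ)) := by
  obtain ⟨T, hT⟩ := hq.exists_forall_norm_sub_le hP hgc hD hV hVβ hQ0 hxs hls
  obtain ⟨hD0, hL, hquad⟩ := hq
  set R := ‖V⁻¹ • Q0 - ls‖ with hR
  have hR0 : 0 ≤ R := norm_nonneg _
  -- Solves `s * L * dist ^ 2 ≤ V / 2 * R ^ 2` as `dist ≤ A / √s`; division by the window length `s`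
  -- then produces the exponent `3 / 2`.
  set A := √(V / (2 * L)) * R with hA
  have hA0 : 0 ≤ A := by positivity
  set K := 2 * V * (‖ls‖ + (A + R) + 1) with hK
  have hK0 : 0 ≤ K := by positivity
  refine ⟨K * A * 3 ^ (3 / 2 : ℝ), by positivity, 2 * T + 2, fun x Q xbar hrun t ht => ?_⟩
  have ht2 : 2 ≤ t := by omega
  set s := t / 2 with hs
  have hs1 : 1 ≤ s := by omega
  have hs0 : (1 : ℝ) ≤ s := by exact_mod_cast hs1
  have hsT : T ≤ s := by omega
  have hdist : ∀ τ, s ≤ τ → ‖V⁻¹ • Q τ - ls‖ ≤ A / √s := by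
    intro τ hτ
    have h1 := hquad _ (hrun.scaled_mem_orthant hV hQ0 τ) (hT x Q xbar hrun τ (hsT.trans hτ))
    have h2 := hrun.mul_dual_gap_le hP hgc hD hV hVβ hQ0 hls τ
    have h3 : (s : ℝ) * (L * ‖V⁻¹ • Q τ - ls‖ ^ 2)
        ≤ τ * (dual f g ls - dual f g (V⁻¹ • Q τ)) := by
      gcongr
      linarith
    have h4 : 0 ≤ V / 2 * ‖V⁻¹ • Q τ - ls‖ ^ 2 := by positivity
    have h5 : (s : ℝ) * (L * ‖V⁻¹ • Q τ - ls‖ ^ 2) ≤ V / 2 * R ^ 2 := by linarith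
    have h6 : ‖V⁻¹ • Q τ - ls‖ ^ 2 ≤ (A / √s) ^ 2 := by
      rw [hA, div_pow, mul_pow, Real.sq_sqrt (by positivity), Real.sq_sqrt (by positivity),
        le_div_iff₀ (by positivity), div_mul_eq_mul_div, le_div_iff₀ (by positivity)]
      linarith
    exact le_of_sq_le_sq h6 (by positivity)
  have hρR : A / √s ≤ A + R := by
    have : A / √s ≤ A := div_le_self hA0 (Real.one_le_sqrt.2 hs0)
    linarith
  have herr := hrun.error_le hP hgc hV hVβ hQ0 hxs ht2 hρR (hdist s le_rfl)
    (hdist (2 * s) (by omega))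
  rw [← hs, ← hK] at herr
  have hbound : K * (A / √s) / s ≤ K * A * 3 ^ (3 / 2 : ℝ) * (1 / (t : ℝ) ^ (3 / 2 : ℝ)) := by
    have ht0 : (0 : ℝ) < t := by positivity
    have e1 : K * (A / √s) / s = K * A / (s : ℝ) ^ (3 / 2 : ℝ) := by
      have : (s : ℝ) ^ (3 / 2 : ℝ) = s * √s := by
        rw [Real.sqrt_eq_rpow, show (3 / 2 : ℝ) = 1 + 1 / 2 by norm_num,
          Real.rpow_add (by positivity), Real.rpow_one]
      rw [this]
      field_simp
    have e2 : K * A * 3 ^ (3 / 2 : ℝ) * (1 / (t : ℝ) ^ (3 / 2 : ℝ))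
        = K * A / ((t : ℝ) / 3) ^ (3 / 2 : ℝ) := by
      rw [Real.div_rpow ht0.le (by norm_num)]
      field_simp
    rw [e1, e2]
    gcongr
    exact div_three_le_half ht2
  exact ⟨herr.1.trans (by linarith), fun k => (herr.2 k).trans hbound⟩

lemma errorDecaysLike_of_isLocallyStronglyConcaveAt (hP : StronglyConvexProgram f g α β)
    (hgc : ∀ k, ConvexOn ℝ Set.univ (g k)) (hD : DualWellDefined f g) (hV : 0 < V)
    (hVβ : m * β ^ 2 / α ≤ V) (hQ0 : Q0 ∈ orthant m) (hxs : IsSolution f g xs)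
    (hls : IsLagrangeMultiplier f g ls) (hc : IsLocallyStronglyConcaveAt f g ls D L) :
    ErrorDecaysLike f g xs V Q0 (fun t => 1 / (t : ℝ) * (1 - L / V) ^ ((t : ℝ) / 4)) := by
  obtain ⟨T, hT⟩ := (hc.isLocallyQuadraticAt hls hxs hD).exists_forall_norm_sub_le
    hP hgc hD hV hVβ hQ0 hxs hls
  have hstep : ∀ x Q xbar, IsShiftedRun f g V Q0 x Q xbar → ∀ t, T ≤ t →
      ‖V⁻¹ • Q (t + 1) - ls‖ ^ 2 ≤ (1 - L / V) * ‖V⁻¹ • Q t - ls‖ ^ 2 :=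
    fun x Q xbar hrun t ht =>
      hrun.norm_sq_succ_le hP hgc hD hV hVβ hQ0 hxs hls hc (hT x Q xbar hrun t ht)
  obtain ⟨-, hL, -⟩ := hc
  -- For `V ≤ L` the base `1 - L / V` is nonpositive and its real power gives no usable bound; the
  -- error constant is then taken to be `0`.
  rcases le_or_gt V L with hVL | hLV
  · -- The scaled queues reach the multiplier in finitely many steps.
    have hθ : 1 - L / V ≤ 0 := sub_nonpos.2 ((one_le_div hV).2 hVL)
    refine ⟨0, le_rfl, 2 * (T + 1), fun x Q xbar hrun t ht => ?_⟩
    have hdist : ∀ τ, T + 1 ≤ τ → ‖V⁻¹ • Q τ - ls‖ ≤ 0 := by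
      intro τ hτ
      obtain ⟨j, rfl⟩ : ∃ j, τ = j + 1 := ⟨τ - 1, by omega⟩
      have h1 := hstep x Q xbar hrun j (by omega)
      have h2 : (1 - L / V) * ‖V⁻¹ • Q j - ls‖ ^ 2 ≤ 0 :=
        mul_nonpos_of_nonpos_of_nonneg hθ (sq_nonneg _)
      exact le_of_sq_le_sq (by rw [zero_pow two_ne_zero]; exact h1.trans h2) le_rfl
    have herr := hrun.error_le hP hgc hV hVβ hQ0 hxs (by omega) (le_refl (0 : ℝ))
      (hdist (t / 2) (by omega)) (hdist (2 * (t / 2)) (by omega))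
    simpa using herr
  · set θ := 1 - L / V with hθ
    have hθ0 : 0 < θ := sub_pos.2 ((div_lt_one hV).2 hLV)
    have hθ1 : θ ≤ 1 := sub_le_self _ (by positivity)
    set R := ‖V⁻¹ • Q0 - ls‖ with hR
    have hR0 : 0 ≤ R := norm_nonneg _
    set K := 2 * V * (‖ls‖ + R + 1) with hK
    have hK0 : 0 ≤ K := by positivity
    -- From `s ≥ (t - 1) / 2`, the exponent `(s - T) / 2` is at least `t / 4 - (1 + 2 * T) / 4`; `B`
    -- absorbs the shift.
    set B := θ ^ (-(1 + 2 * T : ℝ) / 4) with hB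
    have hB0 : 0 ≤ B := by positivity
    refine ⟨K * R * B * 3, by positivity, 2 * T + 2, fun x Q xbar hrun t ht => ?_⟩
    have ht2 : 2 ≤ t := by omega
    set s := t / 2 with hs
    have hs1 : 1 ≤ s := by omega
    have hsT : T ≤ s := by omega
    have hgeom : ∀ j, ‖V⁻¹ • Q (T + j) - ls‖ ^ 2 ≤ θ ^ j * R ^ 2 := by
      intro j
      induction j with
      | zero =>
        have := hrun.norm_sub_le hP hgc hD hV hVβ hQ0 hxs hls T
        rw [pow_zero, one_mul, add_zero]
        gcongr
      | succ j ih =>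
        calc ‖V⁻¹ • Q (T + (j + 1)) - ls‖ ^ 2
            ≤ θ * ‖V⁻¹ • Q (T + j) - ls‖ ^ 2 := hstep x Q xbar hrun (T + j) (by omega)
          _ ≤ θ * (θ ^ j * R ^ 2) := by gcongr
          _ = θ ^ (j + 1) * R ^ 2 := by ring
    have hdist : ∀ τ, s ≤ τ → ‖V⁻¹ • Q τ - ls‖ ≤ θ ^ (((s : ℝ) - T) / 2) * R := by
      intro τ hτ
      obtain ⟨j, rfl⟩ : ∃ j, τ = T + j := ⟨τ - T, by omega⟩
      refine le_of_sq_le_sq ((hgeom j).trans ?_) (by positivity)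
      rw [mul_pow, ← Real.rpow_mul_natCast hθ0.le, ← Real.rpow_natCast]
      gcongr 1
      apply Real.rpow_le_rpow_of_exponent_ge hθ0 hθ1
      have : (s : ℝ) ≤ T + j := by exact_mod_cast hτ
      push_cast
      linarith
    have hρR : θ ^ (((s : ℝ) - T) / 2) * R ≤ R := by
      have hsT' : (T : ℝ) ≤ s := by exact_mod_cast hsT
      exact mul_le_of_le_one_left hR0 (Real.rpow_le_one hθ0.le hθ1 (by linarith))
    have herr := hrun.error_le hP hgc hV hVβ hQ0 hxs ht2 hρR (hdist s le_rfl)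
      (hdist (2 * s) (by omega))
    rw [← hs, ← hK] at herr
    have hbound : K * (θ ^ (((s : ℝ) - T) / 2) * R) / s
        ≤ K * R * B * 3 * (1 / (t : ℝ) * θ ^ ((t : ℝ) / 4)) := by
      have ht0 : (0 : ℝ) < t := by positivity
      have h1 : θ ^ (((s : ℝ) - T) / 2) ≤ B * θ ^ ((t : ℝ) / 4) := by
        rw [hB, ← Real.rpow_add hθ0]
        apply Real.rpow_le_rpow_of_exponent_ge hθ0 hθ1
        have : (t : ℝ) ≤ 2 * s + 1 := by
          have : t ≤ 2 * s + 1 := by omega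
          exact_mod_cast this
        linarith
      calc K * (θ ^ (((s : ℝ) - T) / 2) * R) / s
          ≤ K * ((B * θ ^ ((t : ℝ) / 4)) * R) / ((t : ℝ) / 3) := by
            gcongr
            exact div_three_le_half ht2
        _ = K * R * B * 3 * (1 / (t : ℝ) * θ ^ ((t : ℝ) / 4)) := by
            field_simp
    exact ⟨herr.1.trans (by linarith), fun k => (herr.2 k).trans hbound⟩

/-- The error bound holds only from `T` on; since `h` tends to infinity at `0`, small `ε` force `t`
past `T`. -/
lemma hasConvergenceTime_of_errorDecaysLike {r : ℕ → ℝ} {h : ℝ → ℝ}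
    (hh : Tendsto h (𝓝[>] 0) atTop) (hdec : ErrorDecaysLike f g xs V Q0 r)
    (hr : ∀ C : ℝ, 0 ≤ C → ∃ C' : ℝ, 0 < C' ∧ ∀ᶠ ε in 𝓝[>] (0 : ℝ), ∀ t : ℕ, 1 ≤ t →
      C' * h ε ≤ t → C * r t ≤ ε) :
    HasConvergenceTime f g xs V Q0 h := by
  obtain ⟨C, hC, T, hT⟩ := hdec
  obtain ⟨C', hC', hev⟩ := hr C hC
  refine ⟨C', hC', ?_⟩
  filter_upwards [hev, (hh.const_mul_atTop hC').eventually_ge_atTop (T + 1 : ℝ)]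
    with ε hε hTε x Q xbar hrun t ht
  have hTt : T + 1 ≤ t := by exact_mod_cast hTε.trans ht
  have hle := hε t (by omega) ht
  obtain ⟨h1, h2⟩ := hT x Q xbar hrun t (by omega)
  exact ⟨h1.trans (by linarith), fun k => (h2 k).trans hle⟩

lemma hasConvergenceTime_rpow
    (hdec : ErrorDecaysLike f g xs V Q0 (fun t => 1 / (t : ℝ) ^ (3 / 2 : ℝ))) :
    HasConvergenceTime f g xs V Q0 (fun ε => 1 / ε ^ (2 / 3 : ℝ)) := by
  refine hasConvergenceTime_of_errorDecaysLike ?_ hdec fun C hC => ?_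
  · have h1 : Tendsto (fun ε : ℝ => ε⁻¹ ^ (2 / 3 : ℝ)) (𝓝[>] 0) atTop :=
      (tendsto_rpow_atTop (by norm_num)).comp tendsto_inv_nhdsGT_zero
    refine h1.congr' ?_
    filter_upwards [self_mem_nhdsWithin] with ε hε
    rw [Real.inv_rpow (le_of_lt hε), one_div]
  · refine ⟨(C + 1) ^ (2 / 3 : ℝ), by positivity, ?_⟩
    filter_upwards [self_mem_nhdsWithin] with ε hε t ht1 ht
    have hε0 : (0 : ℝ) < ε := hε
    have ht0 : (0 : ℝ) < t := by positivity
    have h1 : ((C + 1) / ε) ^ (2 / 3 : ℝ) ≤ t := by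
      rw [Real.div_rpow (by positivity) hε0.le]
      rwa [mul_one_div] at ht
    have h2 : (C + 1) / ε ≤ (t : ℝ) ^ (3 / 2 : ℝ) := by
      have := Real.rpow_le_rpow (by positivity) h1 (by norm_num : (0 : ℝ) ≤ 3 / 2)
      rwa [← Real.rpow_mul (by positivity), show (2 / 3 : ℝ) * (3 / 2) = 1 by norm_num,
        Real.rpow_one] at this
    rw [div_le_iff₀ hε0] at h2
    rw [mul_one_div, div_le_iff₀ (by positivity)]
    linarith

lemma hasConvergenceTime_log {θ : ℝ} (hθ0 : 0 < θ) (hθ1 : θ < 1)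
    (hdec : ErrorDecaysLike f g xs V Q0 (fun t => 1 / (t : ℝ) * θ ^ ((t : ℝ) / 4))) :
    HasConvergenceTime f g xs V Q0 (fun ε => Real.log (1 / ε)) := by
  refine hasConvergenceTime_of_errorDecaysLike ?_ hdec fun C hC => ?_
  · simp only [one_div]
    exact Real.tendsto_log_atTop.comp tendsto_inv_nhdsGT_zero
  · have hlog : Real.log θ < 0 := Real.log_neg hθ0 hθ1
    -- This makes `θ ^ (t / 4) ≤ ε ^ 2`: one factor `ε` absorbs `C`, the other is the accuracy.
    refine ⟨8 / -Real.log θ, div_pos (by norm_num) (by linarith), ?_⟩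
    have hpos : (0 : ℝ) < 1 / (C + 1) := by positivity
    filter_upwards [Ioo_mem_nhdsGT hpos] with ε hε t ht1 ht
    obtain ⟨hε0, hε1⟩ := hε
    have ht1' : (1 : ℝ) ≤ t := by exact_mod_cast ht1
    have h1 : θ ^ ((t : ℝ) / 4) ≤ ε ^ 2 := by
      rw [Real.rpow_def_of_pos hθ0, ← Real.exp_log hε0, ← Real.exp_nat_mul, Real.exp_le_exp]
      rw [div_mul_eq_mul_div, div_le_iff₀ (by linarith), one_div, Real.log_inv] at ht
      push_cast
      linarith
    have h2 : 1 / (t : ℝ) ≤ 1 := by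
      rw [div_le_one (by linarith)]; exact ht1'
    have h3 : 1 / (t : ℝ) * θ ^ ((t : ℝ) / 4) ≤ 1 * ε ^ 2 := by gcongr
    rw [lt_div_iff₀ (by positivity)] at hε1
    calc C * (1 / (t : ℝ) * θ ^ ((t : ℝ) / 4)) ≤ C * (1 * ε ^ 2) := by gcongr
      _ = ε * (ε * C) := by ring
      _ ≤ ε * 1 := by gcongr; linarith
      _ = ε := mul_one ε

lemma IsLocallyStronglyConcaveAt.mono {L' : ℝ} (hc : IsLocallyStronglyConcaveAt f g ls D L)
    (hL' : 0 < L') (hle : L' ≤ L) : IsLocallyStronglyConcaveAt f g ls D L' :=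
  ⟨hc.1, hL', hc.2.2.mono hle⟩

end Rates

end DriftPlusPenalty
-- The main theorem.
open DriftPlusPenalty in
theorem theorem11 {n m : ℕ} (f : EuclideanSpace ℝ (Fin n) → ℝ)
    (g : Fin m → EuclideanSpace ℝ (Fin n) → ℝ) (xs : EuclideanSpace ℝ (Fin n))
    (hf : ContDiff ℝ 2 f)
    (hf_sc : ∃ α : ℝ, 0 < α ∧ StrongConvexOn Set.univ α f)
    (hg : ∀ k, ContDiff ℝ 2 (g k))
    (hg_conv : ∀ k, ConvexOn ℝ Set.univ (g k))
    (hg_lip : ∀ k, ∃ β : ℝ, 0 < β ∧ ∀ x y, |g k y - g k x| ≤ β * ‖y - x‖)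
    (hxs : IsSolution f g xs)
    (hJ : HasBoundedJacobian g) :
    ((activeJacobian g xs).rank = Nat.card {k : Fin m // g k xs = 0} →
      DualWellDefined f g ∧
      (∃ α β, StronglyConvexProgram f g α β) ∧
      StrongDuality f g ∧
      (∃ γ, SmoothDual f g γ) ∧
      LocallyQuadraticDual f g ∧
      ∀ α β γ V : ℝ, ∀ Q0 ∈ orthant m,
        StronglyConvexProgram f g α β → SmoothDual f g γ →
        0 < V → max (m * β ^ 2 / α) γ ≤ V →
          (∃ x Q xbar, IsShiftedRun f g V Q0 x Q xbar) ∧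
          ErrorDecaysLike f g xs V Q0 (fun t => 1 / (t : ℝ) ^ (3 / 2 : ℝ)) ∧
          HasConvergenceTime f g xs V Q0 (fun ε => 1 / ε ^ (2 / 3 : ℝ))) ∧
    ((jacobian g xs).rank = m →
      DualWellDefined f g ∧
      (∃ α β, StronglyConvexProgram f g α β) ∧
      StrongDuality f g ∧
      (∃ γ, SmoothDual f g γ) ∧
      LocallyStronglyConcaveDual f g ∧
      ∀ α β γ V : ℝ, ∀ Q0 ∈ orthant m,
        StronglyConvexProgram f g α β → SmoothDual f g γ →
        0 < V → max (m * β ^ 2 / α) γ ≤ V →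
          (∃ x Q xbar, IsShiftedRun f g V Q0 x Q xbar) ∧
          (∀ ls D L, IsLagrangeMultiplier f g ls → IsLocallyStronglyConcaveAt f g ls D L →
            ErrorDecaysLike f g xs V Q0
              (fun t => 1 / (t : ℝ) * (1 - L / V) ^ ((t : ℝ) / 4))) ∧
          HasConvergenceTime f g xs V Q0 (fun ε => Real.log (1 / ε))) := by
  obtain ⟨α₀, β₀, hP₀⟩ := exists_stronglyConvexProgram hf_sc hg_lip
  have hfc := hf.continuous
  have hfd : DifferentiableAt ℝ f xs := hf.differentiable (by norm_num) xs
  have hgd : ∀ k, DifferentiableAt ℝ (g k) xs := fun k =>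
    (hg k).differentiable (by norm_num) xs
  have hD := dualWellDefined hP₀ hfc hg_conv
  refine ⟨fun hrank => ?_, fun hrank => ?_⟩
  · have hsurj := exists_fderiv_eq_of_rank_activeJacobian hrank
    have hSD := strongDuality_of_surjective hP₀ hg_conv hxs hfd hgd hsurj
    have hLQ := locallyQuadraticDual hP₀ hD hf hg hxs hsurj
    refine ⟨hD, ⟨α₀, β₀, hP₀⟩, hSD, exists_smoothDual hP₀ hfc hg_conv, hLQ, ?_⟩
    intro α β γ V Q0 hQ0 hP _ hV hVmax
    have hVβ := (le_max_left _ _).trans hVmax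
    obtain ⟨ls, hls⟩ := hSD
    obtain ⟨D, L, hq⟩ := hLQ ls hls
    have hdec := errorDecaysLike_of_isLocallyQuadraticAt hP hg_conv hD hV hVβ hQ0 hxs hls hq
    exact ⟨exists_isShiftedRun hP hfc hg_conv hV hQ0, hdec, hasConvergenceTime_rpow hdec⟩
  · have hsurj := exists_fderiv_eq_of_rank_jacobian hrank
    have hSD := strongDuality_of_surjective hP₀ hg_conv hxs hfd hgd
      fun b => (hsurj b).imp fun d hd k _ => hd k
    have hLC := locallyStronglyConcaveDual hP₀ hD hg_conv hf hg hxs hsurj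
    refine ⟨hD, ⟨α₀, β₀, hP₀⟩, hSD, exists_smoothDual hP₀ hfc hg_conv, hLC, ?_⟩
    intro α β γ V Q0 hQ0 hP _ hV hVmax
    have hVβ := (le_max_left _ _).trans hVmax
    refine ⟨exists_isShiftedRun hP hfc hg_conv hV hQ0, fun ls D L hls hc =>
      errorDecaysLike_of_isLocallyStronglyConcaveAt hP hg_conv hD hV hVβ hQ0 hxs hls hc, ?_⟩
    obtain ⟨ls, hls⟩ := hSD
    obtain ⟨D, L, hc⟩ := hLC ls hls
    have hL : 0 < L := hc.2.1
    -- Lowering the modulus preserves strong concavity and puts the base `1 - L / V` strictly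
    -- between `0` and `1`, as the logarithm needs.
    have hlt : min L (V / 2) < V := (min_le_right _ _).trans_lt (half_lt_self hV)
    have hpos : 0 < min L (V / 2) := by positivity
    exact hasConvergenceTime_log (sub_pos.2 ((div_lt_one hV).2 hlt))
      (sub_lt_self _ (by positivity))
      (errorDecaysLike_of_isLocallyStronglyConcaveAt hP hg_conv hD hV hVβ hQ0 hxs hls
        (hc.mono hpos (min_le_left _ _)))
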